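/- Let $\boldsymbol a=(a_\ell)_{\ell\in\mathbb Z}\in\ell^1(\mathbb Z;\mathbb C)$ be such that the series $F_{\boldsymbol a}(\kappa)=\sum_{\ell\in\mathbb Z}a_\ell\kappa^\ell$ converges to a holomorphic function on an annulus $\{1-\varepsilon<|\kappa|<1+\varepsilon\}$ for some $\varepsilon>0$, and $\sup_{|\kappa|=1}|F_{\boldsymbol a}(\kappa)|=1$. Suppose that the set of points of the unit circle at which $|F_{\boldsymbol a}|=1$ is a finite set of pairwise distinct points $\{\underline\kappa_1,\dots,\underline\kappa_K\}$, $K\ge1$, and that for each $k\in\{1,\dots,K\}$ there are $\alpha_k\in\mathbb R$, $\beta_k\in\mathbb C$ with $\operatorname{Re}\beta_k>0$ and an integer $\mu_k\ge1$ such that, as the complex number $\xi$ tends to $0$, $$F_{\boldsymbol a}(\underline\kappa_k e^{i\xi})=F_{\boldsymbol a}(\underline\kappa_k)\exp\big(i\alpha_k\xi-\beta_k\xi^{2\mu_k}+O(\xi^{2\mu_k+1})\big).$$ Write $(\boldsymbol a\star\boldsymbol b)_\ell=\sum_{\ell'\in\mathbb Z}a_{\ell-\ell'}b_{\ell'}$,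 $\boldsymbol a^{\star1}=\boldsymbol a$, $\boldsymbol a^{\star(n+1)}=\boldsymbol a^{\star n}\star\boldsymbol a$. For $\mu\in\mathbb N^*$, $\operatorname{Re}\beta>0$ and $x\in\mathbb R$, let $$H^\beta_{2\mu}(x)=\frac1{2\pi}\int_{\mathbb R}e^{-ix\theta}e^{-\beta\theta^{2\mu}}\,d\theta .$$ Let the complex numbers $\gamma_{k,\nu}$, $\nu\ge2\mu_k+1$, be defined by the power series expansion, convergent for small complex $\xi$, $$F_{\boldsymbol a}(\underline\kappa_k e^{i\xi})=F_{\boldsymbol a}(\underline\kappa_k)\exp\Big(i\alpha_k\xi-\beta_k\xi^{2\mu_k}+\sum_{\nu\ge2\mu_k+1}\frac{\gamma_{k,\nu}}{\nu!}(i\xi)^\nu\Big),$$ and let the polynomials $P_{k,m}\in\mathbb C[Y]$, $m\ge1$, be defined by the formal power series identity $$\exp\Big(\sum_{\nu\ge1}\frac{\gamma_{k,2\mu_k+\nu}}{(2\mu_k+\nu)!}Y^{2\mu_k+\nu}Z^\nu\Big)=1+\sum_{m\ge1}P_{k,m}(Y)Z^m .$$ For $n\in\mathbb N^*$ and $m\ge1$,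 define the sequences $$\big(\boldsymbol h^{n}_{k,0}\big)_\ell=\frac{\underline\kappa_k^{-\ell}F_{\boldsymbol a}(\underline\kappa_k)^n}{n^{1/(2\mu_k)}}\,H^{\beta_k}_{2\mu_k}\Big(\frac{\ell-\alpha_kn}{n^{1/(2\mu_k)}}\Big),\qquad \big(\boldsymbol h^{n}_{k,m}\big)_\ell=\frac{\underline\kappa_k^{-\ell}F_{\boldsymbol a}(\underline\kappa_k)^n}{n^{(m+1)/(2\mu_k)}}\,\Big(P_{k,m}(-\mathrm d/\mathrm dx)H^{\beta_k}_{2\mu_k}\Big)\Big(\frac{\ell-\alpha_kn}{n^{1/(2\mu_k)}}\Big).$$ Then for every integer $M\ge0$ there is a constant $C_M>0$ such that for every $p\in[1,+\infty]$, every $\boldsymbol u^0\in\ell^p(\mathbb Z;\mathbb C)$ and every integer $n\ge1$, the convolutions below are given by convergent series, the sequence inside the norm belongs to $\ell^p$, and $$\Big\|\boldsymbol a^{\star n}\star\boldsymbol u^0-\sum_{k=1}^K\boldsymbol h^n_{k,0}\star\boldsymbol u^0-\sum_{m=1}^M\sum_{k=1}^K\boldsymbol h^n_{k,m}\star\boldsymbol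 u^0\Big\|_{\ell^p}\le\frac{C_M\,\|\boldsymbol u^0\|_{\ell^p}}{n^{(M+1)/(2\mu)}},\qquad \mu:=\max_{1\le k\le K}\mu_k .$$ -/

import Mathlib

open Filter Topology Asymptotics Polynomial
open scoped ENNReal

noncomputable section

namespace LocalLimit

/-- The convolution of two sequences indexed by `ℤ`, where the series converges. -/
def conv (a b : ℤ → ℂ) : ℤ → ℂ :=
  fun l => ∑' j : ℤ, a (l - j) * b j

/-- The series that define the convolution `conv a b` all converge (absolutely). -/
def ConvDefined (a b : ℤ → ℂ) : Prop :=
  ∀ l : ℤ, Summable fun j : ℤ => a (l - j) * b j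

/-- Iterated convolution: `convPow a 1 = a` and
`convPow a (n + 1) = conv (convPow a n) a`; by convention `convPow a 0` is the unit sequence. -/
def convPow (a : ℤ → ℂ) : ℕ → ℤ → ℂ
  | 0 => Pi.single 0 1
  | n + 1 => conv (convPow a n) a

theorem convPow_one (a : ℤ → ℂ) : convPow a 1 = a := by
  funext l
  have h : ∀ j : ℤ, j ≠ l → (Pi.single 0 1 : ℤ → ℂ) (l - j) * a j = 0 := by
    intro j hj
    have h0 : l - j ≠ 0 := fun h => hj (by omega)
    rw [Pi.single_eq_of_ne h0, zero_mul]
  change ∑' j : ℤ, (Pi.single 0 1 : ℤ → ℂ) (l - j) * a j = a l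
  rw [tsum_eq_single l h]
  simp

/-- The Fourier (Laurent) series `κ ↦ ∑ a_ℓ κ^ℓ`. -/
def symbol (a : ℤ → ℂ) (κ : ℂ) : ℂ :=
  ∑' l : ℤ, a l * κ ^ l

/-- The sequence is in `ℓ¹`, its Fourier series converges to a holomorphic function on an
annulus around the unit circle, and the supremum of its modulus on the circle is `1`. -/
structure HolomorphicNormalized (a : ℤ → ℂ) : Prop where
  mem_l1 : Memℓp a 1
  holomorphic : ∃ ε : ℝ, 0 < ε ∧
    (∀ ζ : ℂ, 1 - ε < ‖ζ‖ → ‖ζ‖ < 1 + ε → Summable fun l : ℤ => a l * ζ ^ l) ∧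
    DifferentiableOn ℂ (symbol a) {ζ : ℂ | 1 - ε < ‖ζ‖ ∧ ‖ζ‖ < 1 + ε}
  isLUB_norm : IsLUB ((fun κ : ℂ => ‖symbol a κ‖) '' Metric.sphere (0 : ℂ) 1) 1

/-- The points `κ 0, …, κ (K - 1)` are exactly the points of the unit circle where the symbol
has modulus `1`, there is at least one of them, and at each of them the symbol has the
parabolic expansion with drift `α k`, diffusion coefficient `β k` and order `2 * μ k`. -/
structure ParabolicTangency (a : ℤ → ℂ) (K : ℕ) (κ : Fin K → ℂ) (α : Fin K → ℝ)
    (β : Fin K → ℂ) (μ : Fin K → ℕ) : Prop where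
  one_le_card : 1 ≤ K
  injective : Function.Injective κ
  norm_point : ∀ k, ‖κ k‖ = 1
  norm_symbol : ∀ k, ‖symbol a (κ k)‖ = 1
  norm_symbol_lt : ∀ z : ℂ, ‖z‖ = 1 → z ∉ Set.range κ → ‖symbol a z‖ < 1
  re_pos : ∀ k, 0 < (β k).re
  order_pos : ∀ k, 1 ≤ μ k
  expansion : ∀ k, ∃ r : ℂ → ℂ,
    (r =O[𝓝 0] fun ξ : ℂ => ξ ^ (2 * μ k + 1)) ∧
    ∀ᶠ ξ : ℂ in 𝓝 0,
      symbol a (κ k * Complex.exp (Complex.I * ξ)) =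
        symbol a (κ k) *
          Complex.exp (Complex.I * (α k : ℂ) * ξ - β k * ξ ^ (2 * μ k) + r ξ)

/-- The attractor `H_{2μ}^β`. -/
def attractor (μ : ℕ) (β : ℂ) (x : ℝ) : ℂ :=
  1 / (2 * (Real.pi : ℂ)) *
    ∫ θ : ℝ, Complex.exp (-Complex.I * (x : ℂ) * (θ : ℂ)) *
      Complex.exp (-β * (θ : ℂ) ^ (2 * μ))

/-- The `ν`-th cumulant of the symbol at the point `κ`: the number `γ` such that
`γ / ν! * (I * ξ) ^ ν` is the term of degree `ν` in the Taylor expansion at `ξ = 0` of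
`log (F (κ * exp (I * ξ)) / F κ)`, where `F` is the symbol of `a`. -/
def cumulant (a : ℤ → ℂ) (κ : ℂ) (ν : ℕ) : ℂ :=
  iteratedDeriv ν
    (fun ξ : ℂ => Complex.log (symbol a (κ * Complex.exp (Complex.I * ξ)) / symbol a κ)) 0 /
      Complex.I ^ ν

/-- The formal power series `∑_{ν ≥ 1} γ_{2μ+ν} / (2μ+ν)! * Y ^ (2μ+ν) * Z ^ ν` in the variable
`Z`, with coefficients that are polynomials in `Y`. -/
def cumulantSeries (γ : ℕ → ℂ) (μ : ℕ) : PowerSeries ℂ[X] :=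
  PowerSeries.mk fun ν =>
    if ν = 0 then 0
    else Polynomial.C (γ (2 * μ + ν) / ((2 * μ + ν).factorial : ℂ)) * Polynomial.X ^ (2 * μ + ν)

/-- The polynomial `P_m`: the coefficient of `Z ^ m` in the exponential of `cumulantSeries γ μ`
(the composition is legitimate because that series has no constant term). -/
def expansionPoly (γ : ℕ → ℂ) (μ m : ℕ) : ℂ[X] :=
  PowerSeries.coeff m ((PowerSeries.exp ℂ[X]).subst (cumulantSeries γ μ))

/-- The function `P(-d/dx) f`. -/
def applyNegDeriv (P : ℂ[X]) (f : ℝ → ℂ) (x : ℝ) : ℂ :=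
  P.sum fun j c => c * (-1) ^ j * iteratedDeriv j f x

/-- The sequence
`l ↦ κ ^ (-l) * F(κ) ^ n / n ^ ((m + 1) / (2μ)) * f ((l - α n) / n ^ (1 / (2μ)))`. -/
def scaledProfile (a : ℤ → ℂ) (κ : ℂ) (α : ℝ) (μ m n : ℕ) (f : ℝ → ℂ) : ℤ → ℂ :=
  fun l =>
    κ ^ (-l) * symbol a κ ^ n / (((n : ℝ) ^ (((m : ℝ) + 1) / (2 * (μ : ℝ))) : ℝ) : ℂ) *
      f (((l : ℝ) - α * (n : ℝ)) / (n : ℝ) ^ (1 / (2 * (μ : ℝ))))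

/-- The leading term at one tangency point. -/
def leadingTerm (a : ℤ → ℂ) (κ : ℂ) (α : ℝ) (β : ℂ) (μ n : ℕ) : ℤ → ℂ :=
  scaledProfile a κ α μ 0 n (attractor μ β)

/-- The corrector of order `m` at one tangency point. -/
def corrector (a : ℤ → ℂ) (κ : ℂ) (α : ℝ) (β : ℂ) (μ m n : ℕ) : ℤ → ℂ :=
  scaledProfile a κ α μ m n
    (applyNegDeriv (expansionPoly (cumulant a κ) μ m) (attractor μ β))

end LocalLimit

end

noncomputable section

namespace LocalLimit

theorem summable_norm_conv_prod {a b : ℤ → ℂ} (ha : Summable fun l => ‖a l‖)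
    (hb : Summable fun l => ‖b l‖) :
    Summable fun x : ℤ × ℤ => ‖a (x.1 - x.2) * b x.2‖ := by
  have h := Summable.mul_norm ha hb
  let e : ℤ × ℤ ≃ ℤ × ℤ :=
    { toFun := fun x => (x.1 - x.2, x.2)
      invFun := fun x => (x.1 + x.2, x.2)
      left_inv := fun x => by simp
      right_inv := fun x => by simp }
  exact (e.summable_iff (f := fun x : ℤ × ℤ => ‖a x.1 * b x.2‖)).2 h

theorem summable_norm_conv {a b : ℤ → ℂ} (ha : Summable fun l => ‖a l‖)
    (hb : Summable fun l => ‖b l‖) : Summable fun l => ‖conv a b l‖ := by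
  have h := summable_norm_conv_prod ha hb
  refine Summable.of_nonneg_of_le (fun _ => norm_nonneg _) (fun l => ?_) h.prod
  exact norm_tsum_le_tsum_norm (h.prod_factor l)

theorem norm_mul_zpow {a : ℤ → ℂ} {ζ : ℂ} (hζ : ‖ζ‖ = 1) (l : ℤ) : ‖a l * ζ ^ l‖ = ‖a l‖ := by
  simp [hζ]

theorem symbol_conv {a b : ℤ → ℂ} (ha : Summable fun l => ‖a l‖)
    (hb : Summable fun l => ‖b l‖) {ζ : ℂ} (hζ : ‖ζ‖ = 1) :
    symbol (conv a b) ζ = symbol a ζ * symbol b ζ := by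
  have hζ0 : ζ ≠ 0 := by rintro rfl; simp at hζ
  set a' : ℤ → ℂ := fun l => a l * ζ ^ l
  set b' : ℤ → ℂ := fun l => b l * ζ ^ l
  have ha' : Summable fun l => ‖a' l‖ := by simpa only [a', norm_mul_zpow hζ] using ha
  have hb' : Summable fun l => ‖b' l‖ := by simpa only [b', norm_mul_zpow hζ] using hb
  have h := summable_norm_conv_prod ha' hb'
  have h1 : symbol (conv a b) ζ = ∑' l : ℤ, ∑' j : ℤ, a' (l - j) * b' j := by
    refine tsum_congr fun l => ?_
    rw [conv, ← tsum_mul_right]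
    refine tsum_congr fun j => ?_
    have : ζ ^ l = ζ ^ (l - j) * ζ ^ j := by rw [← zpow_add₀ hζ0]; simp
    simp only [a', b', this]; ring
  have h2 : ∑' l : ℤ, ∑' j : ℤ, a' (l - j) * b' j = ∑' j : ℤ, ∑' l : ℤ, a' (l - j) * b' j :=
    (Summable.tsum_comm (f := fun l j => a' (l - j) * b' j) h.of_norm).symm
  rw [h1, h2]
  have h3 : ∀ j : ℤ, ∑' l : ℤ, a' (l - j) * b' j = symbol a ζ * b' j := by
    intro j
    rw [tsum_mul_right]
    congr 1
    exact (Equiv.subRight j).tsum_eq a'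
  simp only [h3, tsum_mul_left]
  rfl

theorem summable_norm_convPow {a : ℤ → ℂ} (ha : Summable fun l => ‖a l‖) (n : ℕ) :
    Summable fun l => ‖convPow a n l‖ := by
  induction n with
  | zero =>
    refine summable_of_ne_finset_zero (s := {0}) fun l hl => ?_
    have : l ≠ 0 := by simpa using hl
    simp [convPow, this]
  | succ n ih => exact summable_norm_conv ih ha

theorem symbol_convPow {a : ℤ → ℂ} (ha : Summable fun l => ‖a l‖) {ζ : ℂ} (hζ : ‖ζ‖ = 1)
    (n : ℕ) : symbol (convPow a n) ζ = symbol a ζ ^ n := by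
  induction n with
  | zero =>
    rw [symbol, tsum_eq_single 0]
    · simp [convPow]
    · intro l hl; simp [convPow, hl]
  | succ n ih =>
    rw [pow_succ, ← ih]
    exact symbol_conv (summable_norm_convPow ha n) ha hζ

/-- Fourier inversion for absolutely summable sequences. -/
theorem coeff_eq_integral {b : ℤ → ℂ} (hb : Summable fun l => ‖b l‖) (l : ℤ) :
    b l = 1 / (2 * (Real.pi : ℂ)) * ∫ θ in (-Real.pi)..Real.pi,
      symbol b (Complex.exp (Complex.I * θ)) * Complex.exp (-Complex.I * l * θ) := by
  have hpi : (Real.pi : ℂ) ≠ 0 := by exact_mod_cast Real.pi_ne_zero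
  let f : ℤ → C(ℝ, ℂ) := fun j => ⟨fun θ => b j * Complex.exp (Complex.I * (j - l) * θ), by fun_prop⟩
  have hnorm : ∀ (j : ℤ) (θ : ℝ), ‖f j θ‖ = ‖b j‖ := by
    intro j θ
    have : Complex.I * (j - l) * θ = ((j - l) * θ : ℝ) * Complex.I := by push_cast; ring
    simp only [f, ContinuousMap.coe_mk, this, norm_mul, Complex.norm_exp_ofReal_mul_I, mul_one]
  have hs : HasSum (fun j => ∫ θ in (-Real.pi)..Real.pi, f j θ)
      (∫ θ in (-Real.pi)..Real.pi, ∑' j, f j θ) := by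
    refine intervalIntegral.hasSum_intervalIntegral_of_summable_norm ?_
    refine Summable.of_nonneg_of_le (fun _ => norm_nonneg _) (fun j => ?_) hb
    rw [ContinuousMap.norm_le _ (norm_nonneg _)]
    intro x
    exact (hnorm j x).le
  have hint : ∀ j : ℤ, j ≠ l → ∫ θ in (-Real.pi)..Real.pi, f j θ = 0 := by
    intro j hj
    have hc : Complex.I * (j - l) ≠ 0 := by
      refine mul_ne_zero Complex.I_ne_zero (sub_ne_zero.2 ?_)
      exact_mod_cast hj
    simp only [f, ContinuousMap.coe_mk, intervalIntegral.integral_const_mul]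
    rw [integral_exp_mul_complex hc]
    have : Complex.exp (Complex.I * (j - l) * Real.pi)
        = Complex.exp (Complex.I * (j - l) * ((-Real.pi : ℝ) : ℂ)) := by
      rw [Complex.exp_eq_exp_iff_exists_int]
      exact ⟨j - l, by push_cast; ring⟩
    rw [this]; simp
  have h1 : ∫ θ in (-Real.pi)..Real.pi, ∑' j, f j θ = b l * (2 * Real.pi) := by
    rw [← hs.tsum_eq, tsum_eq_single l hint]
    simp [f]; ring
  have h2 : ∫ θ in (-Real.pi)..Real.pi,
      symbol b (Complex.exp (Complex.I * θ)) * Complex.exp (-Complex.I * l * θ)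
      = ∫ θ in (-Real.pi)..Real.pi, ∑' j, f j θ := by
    congr 1; ext θ
    rw [symbol, ← tsum_mul_right]
    refine tsum_congr fun j => ?_
    simp only [f, ContinuousMap.coe_mk]
    rw [← Complex.exp_int_mul, mul_assoc, ← Complex.exp_add]
    congr 2; ring
  rw [h2, h1]
  field_simp

section Young

variable {p : ℝ≥0∞}

theorem memℓp_shift {u : ℤ → ℂ} (hu : Memℓp u p) (j : ℤ) : Memℓp (fun l => u (l - j)) p := by
  rcases p.trichotomy with rfl | rfl | hp
  · rw [memℓp_zero_iff] at hu ⊢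
    exact hu.preimage (sub_left_injective (b := j)).injOn
  · rw [memℓp_infty_iff] at hu ⊢
    refine hu.mono ?_
    rintro _ ⟨l, rfl⟩
    exact ⟨l - j, rfl⟩
  · rw [memℓp_gen_iff hp] at hu ⊢
    exact ((Equiv.subRight j).summable_iff (f := fun l => ‖u l‖ ^ p.toReal)).2 hu

/-- The translate of an `ℓ^p` sequence. -/
def shift (j : ℤ) (u : lp (fun _ : ℤ => ℂ) p) : lp (fun _ : ℤ => ℂ) p :=
  ⟨fun l => u (l - j), memℓp_shift (lp.memℓp u) j⟩

theorem norm_shift (hp : 1 ≤ p) (j : ℤ) (u : lp (fun _ : ℤ => ℂ) p) : ‖shift j u‖ = ‖u‖ := by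
  rcases p.trichotomy with rfl | rfl | hp'
  · simp at hp
  · rw [lp.norm_eq_ciSup, lp.norm_eq_ciSup]
    exact (Equiv.subRight j).iSup_congr fun l => rfl
  · rw [lp.norm_eq_tsum_rpow hp', lp.norm_eq_tsum_rpow hp']
    congr 1
    exact (Equiv.subRight j).tsum_eq fun l => ‖u l‖ ^ p.toReal

theorem convDefined_of_summable (hp : 1 ≤ p) {E : ℤ → ℂ} (hE : Summable fun l => ‖E l‖)
    (u : lp (fun _ : ℤ => ℂ) p) : ConvDefined E u := by
  intro l
  have h0 : p ≠ 0 := (zero_lt_one.trans_le hp).ne'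
  refine Summable.of_norm_bounded (g := fun j => ‖E (l - j)‖ * ‖u‖) ?_ fun j => ?_
  · exact (((Equiv.subLeft l).summable_iff (f := fun j => ‖E j‖)).2 hE).mul_right _
  · rw [norm_mul]
    gcongr
    exact lp.norm_apply_le_norm h0 u j

/-- Young's inequality `ℓ¹ * ℓ^p ⊆ ℓ^p`. -/
theorem exists_lp_conv (hp : 1 ≤ p) {E : ℤ → ℂ} (hE : Summable fun l => ‖E l‖)
    (u : lp (fun _ : ℤ => ℂ) p) :
    ∃ e : lp (fun _ : ℤ => ℂ) p, (∀ l, e l = conv E u l) ∧ ‖e‖ ≤ (∑' l, ‖E l‖) * ‖u‖ := by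
  have : Fact (1 ≤ p) := ⟨hp⟩
  have h0 : p ≠ 0 := (zero_lt_one.trans_le hp).ne'
  have hn : ∀ j, ‖E j • shift j u‖ = ‖E j‖ * ‖u‖ := fun j => by
    rw [lp.norm_const_smul h0, norm_shift hp]
  have hs : Summable fun j => ‖E j • shift j u‖ := by
    simpa only [hn] using hE.mul_right ‖u‖
  refine ⟨∑' j, E j • shift j u, fun l => ?_, ?_⟩
  · let ev : lp (fun _ : ℤ => ℂ) p →+ ℂ := 
      { toFun := fun f => f l, map_zero' := by simp, map_add' := fun f g => by simp }
    have hev : Continuous ev := (lp.lipschitzWith_one_eval (E := fun _ : ℤ => ℂ) p l).continuous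
    have h1 : ev (∑' j, E j • shift j u) = ∑' j, ev (E j • shift j u) :=
      (hs.of_norm.map_tsum ev hev)
    have h2 : ∀ j, ev (E j • shift j u) = E j * u (l - j) := fun j => rfl
    change ev _ = _
    rw [h1, conv, ← (Equiv.subLeft l).tsum_eq]
    refine tsum_congr fun j => ?_
    rw [h2]; simp
  · refine (norm_tsum_le_tsum_norm hs).trans ?_
    simp only [hn, tsum_mul_right]; exact le_rfl

end Young

theorem conv_sub_left {a b : ℤ → ℂ} {u : ℤ → ℂ} (ha : ConvDefined a u) (hb : ConvDefined b u)
    (l : ℤ) : conv (fun l => a l - b l) u l = conv a u l - conv b u l := by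
  simp only [conv, sub_mul]
  exact (ha l).tsum_sub (hb l)

theorem conv_sum_left {ι : Type*} {s : Finset ι} {a : ι → ℤ → ℂ} {u : ℤ → ℂ}
    (ha : ∀ i ∈ s, ConvDefined (a i) u) (l : ℤ) :
    conv (fun l => ∑ i ∈ s, a i l) u l = ∑ i ∈ s, conv (a i) u l := by
  simp only [conv, Finset.sum_mul]
  exact Summable.tsum_finsetSum fun i hi => ha i hi l

theorem sum_range_inv_one_add_sq_le {N : ℝ} (hN : 1 ≤ N) (m : ℕ) :
    ∑ l ∈ Finset.range m, (1 + (((l : ℝ) + 1) / N) ^ 2)⁻¹ ≤ 2 * N := by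
  have hN0 : 0 < N := by linarith
  have key : ∑ l ∈ Finset.range m, (1 + (((l : ℝ) + 1) / N) ^ 2)⁻¹
      ≤ 2 * N ^ 2 * (1 / N - 1 / (N + m)) := by
    induction m with
    | zero => simp
    | succ m ih =>
      rw [Finset.sum_range_succ]
      have hm : (0 : ℝ) ≤ m := Nat.cast_nonneg m
      have : (1 + (((m : ℝ) + 1) / N) ^ 2)⁻¹ ≤ 2 * N ^ 2 * (1 / (N + m) - 1 / (N + (m + 1))) := by
        have e1 : (1 + (((m : ℝ) + 1) / N) ^ 2)⁻¹ = N ^ 2 / (N ^ 2 + (m + 1) ^ 2) := by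
          field_simp
        have e2 : 2 * N ^ 2 * (1 / (N + m) - 1 / (N + (m + 1)))
            = N ^ 2 / ((N + m) * (N + (m + 1)) / 2) := by
          field_simp; ring
        rw [e1, e2]
        refine div_le_div_of_nonneg_left (by positivity) (by positivity) ?_
        nlinarith [sq_nonneg (N - (m + 1))]
      push_cast
      linarith
  refine key.trans ?_
  have : 0 ≤ 1 / (N + m) := by positivity
  have e : 2 * N ^ 2 * (1 / N) = 2 * N := by field_simp
  nlinarith [sq_nonneg N, mul_nonneg (sq_nonneg N) this]

theorem summable_inv_one_add_sq_and_tsum_le {N : ℝ} (hN : 1 ≤ N) (c : ℝ) :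
    Summable (fun l : ℤ => (1 + (((l : ℝ) - c) / N) ^ 2)⁻¹) ∧
      ∑' l : ℤ, (1 + (((l : ℝ) - c) / N) ^ 2)⁻¹ ≤ 15 * N := by
  have hN0 : 0 < N := by linarith
  let g : ℤ → ℝ := fun l => (1 + ((l : ℝ) / N) ^ 2)⁻¹
  have hg0 : ∀ l, 0 ≤ g l := fun l => by positivity
  have hpart : HasSum (fun l : ℕ => g (l + 1)) (∑' l : ℕ, g (l + 1)) ∧
      ∑' l : ℕ, g (l + 1) ≤ 2 * N := by
    have hb : ∀ m, ∑ l ∈ Finset.range m, g (l + 1) ≤ 2 * N := fun m => by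
      simpa [g] using sum_range_inv_one_add_sq_le hN m
    exact ⟨(summable_of_sum_range_le (fun l => hg0 _) hb).hasSum,
      Real.tsum_le_of_sum_range_le (fun l => hg0 _) hb⟩
  have hneg : ∀ l : ℕ, g (-(l + 1)) = g (l + 1) := fun l => by simp [g]; ring_nf
  have hgs : HasSum g (∑' l : ℕ, g (l + 1) + g 0 + ∑' l : ℕ, g (l + 1)) := by
    refine HasSum.of_add_one_of_neg_add_one ?_ ?_
    · exact hpart.1
    · simpa only [hneg] using hpart.1
  have hg1 : ∑' l, g l ≤ 5 * N := by
    rw [hgs.tsum_eq]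
    have : g 0 = 1 := by simp [g]
    linarith [hpart.2]
  have hcomp : ∀ l : ℤ, (1 + (((l : ℝ) - c) / N) ^ 2)⁻¹ ≤ 3 * g (l - ⌊c⌋) := by
    intro l
    have hf0 := Int.fract_nonneg c
    have hf1 := Int.fract_lt_one c
    have hc : c = ⌊c⌋ + Int.fract c := (Int.floor_add_fract c).symm
    set d : ℝ := (l : ℝ) - ⌊c⌋
    have e1 : (l : ℝ) - c = d - Int.fract c := by simp only [d]; linarith
    have e2 : g (l - ⌊c⌋) = (1 + (d / N) ^ 2)⁻¹ := by simp [g, d]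
    rw [e1, e2, ← div_eq_mul_inv, ← one_div, div_le_div_iff₀ (by positivity) (by positivity)]
    have h3 : (d / N) ^ 2 ≤ 2 * ((d - Int.fract c) / N) ^ 2 + 2 := by
      have h4 : d / N = (d - Int.fract c) / N + Int.fract c / N := by ring
      have h5 : Int.fract c / N ≤ 1 := by rw [div_le_one hN0]; linarith
      have h6 : 0 ≤ Int.fract c / N := by positivity
      rw [h4]
      nlinarith [sq_nonneg ((d - Int.fract c) / N - Int.fract c / N)]
    nlinarith [sq_nonneg ((d - Int.fract c) / N)]
  have hgshift : Summable fun l : ℤ => 3 * g (l - ⌊c⌋) :=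
    (((Equiv.subRight ⌊c⌋).summable_iff (f := g)).2 hgs.summable).mul_left 3
  have hsum : Summable (fun l : ℤ => (1 + (((l : ℝ) - c) / N) ^ 2)⁻¹) :=
    Summable.of_nonneg_of_le (fun l => by positivity) hcomp hgshift
  refine ⟨hsum, (hsum.tsum_le_tsum hcomp hgshift).trans ?_⟩
  have h7 : ∑' l : ℤ, g (l - ⌊c⌋) = ∑' l, g l := (Equiv.subRight ⌊c⌋).tsum_eq g
  rw [tsum_mul_left, h7]
  linarith

end LocalLimit

end

noncomputable section

namespace LocalLimit

/-- `f` is twice continuously differentiable near `t` and its derivatives of order at most two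
at `t` are bounded by `b`. -/
structure C2BoundAt (f : ℝ → ℂ) (b t : ℝ) : Prop where
  contDiffAt : ContDiffAt ℝ 2 f t
  norm_le : ∀ j ≤ 2, ‖iteratedDeriv j f t‖ ≤ b

namespace C2BoundAt

variable {f g : ℝ → ℂ} {b c t : ℝ}

theorem nonneg (hf : C2BoundAt f b t) : 0 ≤ b := (norm_nonneg _).trans (hf.norm_le 0 (by norm_num))

theorem mono (hf : C2BoundAt f b t) (h : b ≤ c) : C2BoundAt f c t :=
  ⟨hf.contDiffAt, fun j hj => (hf.norm_le j hj).trans h⟩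

theorem congr (hf : C2BoundAt f b t) (h : g =ᶠ[𝓝 t] f) : C2BoundAt g b t :=
  ⟨hf.contDiffAt.congr_of_eventuallyEq h, fun j hj => by
    rw [h.iteratedDeriv_eq]; exact hf.norm_le j hj⟩

theorem contDiffAt_of_le (hf : C2BoundAt f b t) {j : ℕ} (hj : j ≤ 2) : ContDiffAt ℝ j f t :=
  hf.contDiffAt.of_le (by exact_mod_cast hj)

theorem mul (hf : C2BoundAt f b t) (hg : C2BoundAt g c t) :
    C2BoundAt (fun x => f x * g x) (4 * (b * c)) t := by
  refine ⟨hf.contDiffAt.mul hg.contDiffAt, fun j hj => ?_⟩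
  rw [iteratedDeriv_fun_mul (hf.contDiffAt_of_le hj) (hg.contDiffAt_of_le hj)]
  have hb := hf.nonneg
  have hc := hg.nonneg
  calc _ ≤ ∑ i ∈ Finset.range (j + 1), (j.choose i : ℝ) * (b * c) := by
        refine norm_sum_le_of_le _ fun i hi => ?_
        have hi' : i ≤ j := Nat.lt_succ_iff.1 (Finset.mem_range.1 hi)
        rw [norm_mul, norm_mul, mul_assoc]
        have h1 := hf.norm_le i (hi'.trans hj)
        have h2 := hg.norm_le (j - i) ((Nat.sub_le _ _).trans hj)
        gcongr
        simp
    _ = 2 ^ j * (b * c) := by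
        rw [← Finset.sum_mul]
        congr 1
        exact_mod_cast Nat.sum_range_choose j
    _ ≤ 4 * (b * c) := by
        have : (2 : ℝ) ^ j ≤ 2 ^ 2 := pow_le_pow_right₀ (by norm_num) hj
        have h4 : (2 : ℝ) ^ 2 = 4 := by norm_num
        rw [h4] at this
        gcongr

theorem add (hf : C2BoundAt f b t) (hg : C2BoundAt g c t) :
    C2BoundAt (fun x => f x + g x) (b + c) t := by
  refine ⟨hf.contDiffAt.add hg.contDiffAt, fun j hj => ?_⟩
  rw [iteratedDeriv_fun_add (hf.contDiffAt_of_le hj) (hg.contDiffAt_of_le hj)]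
  exact norm_add_le_of_le (hf.norm_le j hj) (hg.norm_le j hj)

theorem sub (hf : C2BoundAt f b t) (hg : C2BoundAt g c t) :
    C2BoundAt (fun x => f x - g x) (b + c) t := by
  refine ⟨hf.contDiffAt.sub hg.contDiffAt, fun j hj => ?_⟩
  rw [iteratedDeriv_fun_sub (hf.contDiffAt_of_le hj) (hg.contDiffAt_of_le hj)]
  exact norm_sub_le_of_le (hf.norm_le j hj) (hg.norm_le j hj)

theorem of_eventuallyEq_zero (h : f =ᶠ[𝓝 t] fun _ => 0) (hb : 0 ≤ b) : C2BoundAt f b t := by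
  refine congr ⟨contDiffAt_const, fun j _ => ?_⟩ h
  simpa using hb

end C2BoundAt

theorem iteratedDeriv_comp_ofReal {f : ℂ → ℂ} {U : Set ℂ} (hU : IsOpen U)
    (hf : DifferentiableOn ℂ f U) (j : ℕ) {x : ℝ} (hx : (x : ℂ) ∈ U) :
    iteratedDeriv j (fun y : ℝ => f y) x = iteratedDeriv j f x := by
  induction j generalizing x with
  | zero => simp
  | succ j ih =>
    rw [iteratedDeriv_succ, iteratedDeriv_succ]
    have hev : iteratedDeriv j (fun y : ℝ => f y) =ᶠ[𝓝 x] fun y : ℝ => iteratedDeriv j f y := by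
      filter_upwards [Complex.continuous_ofReal.continuousAt.preimage_mem_nhds (hU.mem_nhds hx)]
        with y hy using ih hy
    rw [hev.deriv_eq]
    have han : AnalyticAt ℂ f x := hf.analyticAt (hU.mem_nhds hx)
    have hd : DifferentiableAt ℂ (iteratedDeriv j f) x := by
      rw [iteratedDeriv_eq_iterate]
      exact (han.iterated_deriv j).differentiableAt
    exact hd.hasDerivAt.comp_ofReal.deriv

/-- Cauchy's estimates. -/
theorem C2BoundAt.of_holomorphic {f : ℂ → ℂ} {U : Set ℂ} (hU : IsOpen U)
    (hf : DifferentiableOn ℂ f U) {η b t : ℝ} (hη : 0 < η) (hη1 : η ≤ 1)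
    (hsub : Metric.closedBall (t : ℂ) η ⊆ U)
    (hb : ∀ ζ ∈ Metric.closedBall (t : ℂ) η, ‖f ζ‖ ≤ b) :
    C2BoundAt (fun x : ℝ => f x) (2 * b / η ^ 2) t := by
  have ht : (t : ℂ) ∈ U := hsub (Metric.mem_closedBall_self hη.le)
  have han : AnalyticAt ℂ f t := hf.analyticAt (hU.mem_nhds ht)
  have hb0 : 0 ≤ b := (norm_nonneg _).trans (hb _ (Metric.mem_closedBall_self hη.le))
  refine ⟨?_, fun j hj => ?_⟩
  · have h1 : ContDiffAt ℝ 2 f t := han.contDiffAt.restrict_scalars ℝ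
    exact h1.comp t Complex.ofRealCLM.contDiff.contDiffAt
  · rw [iteratedDeriv_comp_ofReal hU hf j ht]
    have hdc : DiffContOnCl ℂ f (Metric.ball (t : ℂ) η) :=
      (hf.mono (Metric.closure_ball_subset_closedBall.trans hsub)).diffContOnCl
    refine (Complex.norm_iteratedDeriv_le_of_forall_mem_sphere_norm_le j hη hdc
      fun z hz => hb z (Metric.sphere_subset_closedBall hz)).trans ?_
    have h1 : (j.factorial : ℝ) ≤ 2 := by
      have := Nat.factorial_le hj
      exact_mod_cast this
    have h2 : η ^ 2 ≤ η ^ j := pow_le_pow_of_le_one hη.le hη1 hj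
    gcongr

theorem C2BoundAt.comp_mul {f : ℝ → ℂ} (hf : ContDiff ℝ 2 f) {z b t : ℝ} (hz : |z| ≤ 1)
    (hb : ∀ j ≤ 2, ‖iteratedDeriv j f (z * t)‖ ≤ b) : C2BoundAt (fun x => f (z * x)) b t := by
  refine ⟨(hf.comp (contDiff_const.mul contDiff_id)).contDiffAt, fun j hj => ?_⟩
  rw [iteratedDeriv_comp_const_smul (hf.of_le (by exact_mod_cast hj))]
  simp only [norm_smul, norm_pow, Real.norm_eq_abs]
  exact (mul_le_of_le_one_left (norm_nonneg _) (pow_le_one₀ (abs_nonneg _) hz)).trans (hb j hj)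

section Fourier

open MeasureTheory FourierTransform

variable {f : ℝ → ℂ} {B : ℝ}

theorem contDiff_of_C2BoundAt {b : ℝ → ℝ} (hf : ∀ t, C2BoundAt f (b t) t) : ContDiff ℝ 2 f :=
  contDiff_iff_contDiffAt.2 fun t => (hf t).contDiffAt

theorem integrable_iteratedDeriv_of_C2BoundAt (hf : ∀ t, C2BoundAt f (B * (1 + t ^ 2)⁻¹) t) {j : ℕ}
    (hj : j ≤ 2) : Integrable (iteratedDeriv j f) ∧
      ∫ t, ‖iteratedDeriv j f t‖ ≤ Real.pi * B := by
  have hc : Continuous (iteratedDeriv j f) :=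
    (contDiff_of_C2BoundAt hf).continuous_iteratedDeriv j (by exact_mod_cast hj)
  have hg : Integrable fun t : ℝ => B * (1 + t ^ 2)⁻¹ := integrable_inv_one_add_sq.const_mul B
  have hi : Integrable (iteratedDeriv j f) :=
    hg.mono' hc.aestronglyMeasurable (Eventually.of_forall fun t => (hf t).norm_le j hj)
  refine ⟨hi, ?_⟩
  calc ∫ t, ‖iteratedDeriv j f t‖ ≤ ∫ t : ℝ, B * (1 + t ^ 2)⁻¹ :=
        integral_mono hi.norm hg fun t => (hf t).norm_le j hj
    _ = Real.pi * B := by rw [integral_const_mul, integral_univ_inv_one_add_sq, mul_comm]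

theorem fourier_eq_integral_exp (f : ℝ → ℂ) (x : ℝ) :
    𝓕 f (x / (2 * Real.pi)) = ∫ t : ℝ, Complex.exp (-Complex.I * x * t) * f t := by
  rw [Real.fourier_real_eq_integral_exp_smul]
  refine integral_congr_ae (Eventually.of_forall fun t => ?_)
  have hpi : (Real.pi : ℂ) ≠ 0 := by exact_mod_cast Real.pi_ne_zero
  simp only [smul_eq_mul]
  congr 2
  push_cast
  field_simp

/-- Quadratic decay of the Fourier integral of a twice differentiable function. -/
theorem norm_integral_exp_mul_le (hf : ∀ t, C2BoundAt f (B * (1 + t ^ 2)⁻¹) t) (x : ℝ) :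
    ‖∫ t : ℝ, Complex.exp (-Complex.I * x * t) * f t‖ ≤ 2 * Real.pi * B * (1 + x ^ 2)⁻¹ := by
  have h0 := integrable_iteratedDeriv_of_C2BoundAt hf (j := 0) (by norm_num)
  have h2 := integrable_iteratedDeriv_of_C2BoundAt hf (j := 2) le_rfl
  rw [← fourier_eq_integral_exp]
  set y := x / (2 * Real.pi) with hy
  have hF := congrFun (Real.fourier_iteratedDeriv (N := 2) (n := 2)
    (by exact_mod_cast contDiff_of_C2BoundAt hf)
    (fun n hn => (integrable_iteratedDeriv_of_C2BoundAt hf (by exact_mod_cast hn)).1) le_rfl) y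
  have hle : ∀ g : ℝ → ℂ, ‖𝓕 g y‖ ≤ ∫ t, ‖g t‖ := fun g =>
    VectorFourier.norm_fourierIntegral_le_integral_norm _ _ _ _ _
  have e1 : ‖(2 * Real.pi * Complex.I * y : ℂ) ^ 2 • 𝓕 f y‖ = x ^ 2 * ‖𝓕 f y‖ := by
    have : (2 * Real.pi * Complex.I * y : ℂ) = x * Complex.I := by
      have hpi : (Real.pi : ℂ) ≠ 0 := by exact_mod_cast Real.pi_ne_zero
      rw [hy]; push_cast; field_simp
    rw [this, norm_smul, norm_pow, norm_mul, Complex.norm_I, Complex.norm_real, mul_one,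
      Real.norm_eq_abs, sq_abs]
  have a1 : ‖𝓕 f y‖ ≤ Real.pi * B := (hle f).trans (by simpa using h0.2)
  have a2 : x ^ 2 * ‖𝓕 f y‖ ≤ Real.pi * B := by
    rw [← e1, ← hF]; exact (hle _).trans h2.2
  rw [← div_eq_mul_inv, le_div_iff₀ (by positivity)]
  linarith

end Fourier

section Periodic

variable {W : ℝ → ℂ} {B : ℝ}

/-- Quadratic decay of the Fourier coefficients of a twice differentiable periodic function. -/
theorem norm_intervalIntegral_exp_mul_le (hper : Function.Periodic W (2 * Real.pi))
    (hW : ∀ t, C2BoundAt W B t) (l : ℤ) :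
    ‖∫ t in (-Real.pi)..Real.pi, W t * Complex.exp (-Complex.I * l * t)‖
      ≤ 4 * Real.pi * B * (1 + (l : ℝ) ^ 2)⁻¹ := by
  have hcd := contDiff_of_C2BoundAt hW
  have hnexp : ∀ t : ℝ, ‖Complex.exp (-Complex.I * l * t)‖ = 1 := fun t => by
    have : -Complex.I * l * t = ((-(l * t) : ℝ) : ℂ) * Complex.I := by push_cast; ring
    rw [this, Complex.norm_exp_ofReal_mul_I]
  have hbound : ∀ V : ℝ → ℂ, (∀ t, ‖V t‖ ≤ B) →
      ‖∫ t in (-Real.pi)..Real.pi, V t * Complex.exp (-Complex.I * l * t)‖ ≤ 2 * Real.pi * B := by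
    intro V hV
    refine (intervalIntegral.norm_integral_le_of_norm_le_const (C := B) fun t _ => ?_).trans ?_
    · rw [norm_mul, hnexp, mul_one]; exact hV t
    · rw [abs_of_nonneg (by linarith [Real.pi_pos])]; linarith
  have hparts : ∀ V V' : ℝ → ℂ, Function.Periodic V (2 * Real.pi) → (∀ t, HasDerivAt V (V' t) t) →
      Continuous V' → ∫ t in (-Real.pi)..Real.pi, V' t * Complex.exp (-Complex.I * l * t)
        = (Complex.I * l) * ∫ t in (-Real.pi)..Real.pi, V t * Complex.exp (-Complex.I * l * t) := by
    intro V V' hVp hV hV'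
    have hv : ∀ t : ℝ, HasDerivAt (fun t : ℝ => Complex.exp (-Complex.I * l * t))
        (-Complex.I * l * Complex.exp (-Complex.I * l * t)) t := fun t => by
      have := ((hasDerivAt_id (t : ℂ)).const_mul (-Complex.I * l)).cexp.comp_ofReal
      simpa [mul_comm] using this
    have := intervalIntegral.integral_mul_deriv_eq_deriv_mul (a := -Real.pi) (b := Real.pi)
      (fun t _ => hV t) (fun t _ => hv t) (hV'.intervalIntegrable _ _)
      (Continuous.intervalIntegrable (by fun_prop) _ _)
    have e1 : V Real.pi = V (-Real.pi) := by
      have := hVp (-Real.pi)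
      rw [← this]; congr 1; ring
    have e2 : Complex.exp (-Complex.I * l * Real.pi)
        = Complex.exp (-Complex.I * l * ((-Real.pi : ℝ) : ℂ)) := by
      rw [Complex.exp_eq_exp_iff_exists_int]
      exact ⟨-l, by push_cast; ring⟩
    rw [e1, e2, sub_self, zero_sub] at this
    rw [← neg_eq_iff_eq_neg.2 this, ← intervalIntegral.integral_const_mul,
      ← intervalIntegral.integral_neg]
    congr 1; ext t; ring
  have hW1 : ∀ t, HasDerivAt W (deriv W t) t := fun t =>
    (hcd.differentiable (by norm_num) t).hasDerivAt
  have hcd1 : ContDiff ℝ 1 (deriv W) := by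
    have h : ContDiff ℝ (1 + 1) W := by simpa [one_add_one_eq_two] using hcd
    exact (contDiff_succ_iff_deriv.1 h).2.2
  have hW2 : ∀ t, HasDerivAt (deriv W) (deriv (deriv W) t) t := fun t =>
    (hcd1.differentiable (by norm_num) t).hasDerivAt
  have hper1 : Function.Periodic (deriv W) (2 * Real.pi) := fun t => by
    rw [← deriv_comp_add_const, show (fun x => W (x + 2 * Real.pi)) = W from funext hper]
  have h1 := hparts W (deriv W) hper hW1 hcd1.continuous
  have h2 := hparts _ _ hper1 hW2 (hcd1.continuous_deriv le_rfl)
  have a1 := hbound W fun t => by simpa using (hW t).norm_le 0 (by norm_num)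
  have a2 := hbound (deriv (deriv W)) fun t => by
    simpa [iteratedDeriv_succ] using (hW t).norm_le 2 le_rfl
  have hn : ‖Complex.I * (l : ℂ)‖ = |(l : ℝ)| := by simp
  rw [h2, h1, norm_mul (Complex.I * (l : ℂ)), norm_mul (Complex.I * (l : ℂ)), hn, ← mul_assoc, ← pow_two, sq_abs] at a2
  rw [← div_eq_mul_inv, le_div_iff₀ (by positivity)]
  linarith

end Periodic

end LocalLimit

end

noncomputable section

namespace LocalLimit

/-- The `m`-th Taylor coefficient at `0` of `w ↦ exp (s * ρ w)`. -/
def expCoeff (ρ : ℂ → ℂ) (s : ℂ) (m : ℕ) : ℂ :=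
  iteratedDeriv m (fun w => Complex.exp (s * ρ w)) 0 / (m.factorial : ℂ)

theorem expCoeff_zero {ρ : ℂ → ℂ} (h0 : ρ 0 = 0) (s : ℂ) : expCoeff ρ s 0 = 1 := by
  simp [expCoeff, h0]

theorem succ_mul_expCoeff_succ {ρ : ℂ → ℂ} (hρ : AnalyticAt ℂ ρ 0) (s : ℂ) (m : ℕ) :
    ((m : ℂ) + 1) * expCoeff ρ s (m + 1) = ∑ x ∈ Finset.HasAntidiagonal.antidiagonal m,
      expCoeff ρ s x.1 * (s * (((x.2 : ℂ) + 1) *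
        (iteratedDeriv (x.2 + 1) ρ 0 / ((x.2 + 1).factorial : ℂ)))) := by
  set E : ℂ → ℂ := fun w => Complex.exp (s * ρ w) with hE
  have hEa : AnalyticAt ℂ E 0 := (analyticAt_const.mul hρ).cexp
  have hev : deriv E =ᶠ[𝓝 0] fun w => E w * (s * deriv ρ w) := by
    filter_upwards [hρ.eventually_analyticAt] with w hw
    exact ((hw.differentiableAt.hasDerivAt.const_mul s).cexp).deriv
  have h1 : iteratedDeriv (m + 1) E 0 = ∑ i ∈ Finset.range (m + 1),
      (m.choose i : ℂ) * iteratedDeriv i E 0 * (s * iteratedDeriv (m - i + 1) ρ 0) := by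
    rw [iteratedDeriv_succ', hev.iteratedDeriv_eq, iteratedDeriv_fun_mul hEa.contDiffAt
      (g := fun w => s * deriv ρ w) (analyticAt_const.mul hρ.deriv).contDiffAt]
    refine Finset.sum_congr rfl fun i _ => ?_
    rw [iteratedDeriv_const_mul_field, iteratedDeriv_succ']
  have hf : ∀ k : ℕ, (k.factorial : ℂ) ≠ 0 := fun k => by exact_mod_cast k.factorial_ne_zero
  have hs : ∀ k : ℕ, ((k : ℂ) + 1) ≠ 0 := fun k => by exact_mod_cast k.succ_ne_zero
  rw [Finset.Nat.sum_antidiagonal_eq_sum_range_succ_mk, expCoeff, ← hE, h1, Finset.sum_div,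
    Finset.mul_sum]
  refine Finset.sum_congr rfl fun i hi => ?_
  have hi' : i ≤ m := Nat.lt_succ_iff.1 (Finset.mem_range.1 hi)
  have hc : (m.choose i : ℂ) * (i.factorial : ℂ) * ((m - i).factorial : ℂ) = m.factorial := by
    exact_mod_cast Nat.choose_mul_factorial_mul_factorial hi'
  have := hf i; have := hf (m - i); have := hf m; have := hs m; have := hs (m - i)
  simp only [expCoeff, ← hE, Nat.factorial_succ, Nat.cast_mul, Nat.cast_add, Nat.cast_one]
  rw [← hc]
  have := left_ne_zero_of_mul (left_ne_zero_of_mul (hc ▸ hf m))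
  field_simp

theorem hasSubst_cumulantSeries (γ : ℕ → ℂ) (μ : ℕ) :
    PowerSeries.HasSubst (cumulantSeries γ μ) :=
  PowerSeries.HasSubst.of_constantCoeff_zero' (by simp [cumulantSeries])

theorem expansionPoly_zero (γ : ℕ → ℂ) (μ : ℕ) : expansionPoly γ μ 0 = 1 := by
  have h : PowerSeries.constantCoeff (cumulantSeries γ μ) = 0 := by simp [cumulantSeries]
  rw [expansionPoly, PowerSeries.coeff_zero_eq_constantCoeff_apply,
    ← PowerSeries.coeff_zero_eq_constantCoeff_apply,
    PowerSeries.coeff_subst' (hasSubst_cumulantSeries γ μ), finsum_eq_single _ 0]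
  · simp
  · intro d hd
    simp [h, hd]

theorem succ_mul_expansionPoly_succ (γ : ℕ → ℂ) (μ m : ℕ) :
    expansionPoly γ μ (m + 1) * ((m : ℂ[X]) + 1) = ∑ x ∈ Finset.HasAntidiagonal.antidiagonal m,
      expansionPoly γ μ x.1 * (Polynomial.C (γ (2 * μ + (x.2 + 1)) /
        ((2 * μ + (x.2 + 1)).factorial : ℂ)) * Polynomial.X ^ (2 * μ + (x.2 + 1))
          * ((x.2 : ℂ[X]) + 1)) := by
  have h := congrArg (PowerSeries.coeff m)
    (PowerSeries.derivative_subst (f := PowerSeries.exp ℂ[X]) (hasSubst_cumulantSeries γ μ))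
  rw [PowerSeries.derivative_exp, PowerSeries.coeff_derivative, PowerSeries.coeff_mul] at h
  simp only [PowerSeries.coeff_derivative] at h
  rw [expansionPoly, h]
  refine Finset.sum_congr rfl fun x _ => ?_
  simp [expansionPoly, cumulantSeries]

/-- The polynomials `P_m` are the Taylor coefficients of an exponential. -/
theorem eval_expansionPoly {γ : ℕ → ℂ} {μ : ℕ} {ρ : ℂ → ℂ} (hρ : AnalyticAt ℂ ρ 0)
    (h0 : ρ 0 = 0) (hγ : ∀ ν, iteratedDeriv (ν + 1) ρ 0 / ((ν + 1).factorial : ℂ) =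
      γ (2 * μ + (ν + 1)) / ((2 * μ + (ν + 1)).factorial : ℂ) * Complex.I ^ (2 * μ + (ν + 1)))
    (t : ℂ) (m : ℕ) :
    (expansionPoly γ μ m).eval (Complex.I * t) = t ^ m * expCoeff ρ (t ^ (2 * μ)) m := by
  induction m using Nat.strong_induction_on with
  | _ m ih =>
    rcases m with _ | m
    · simp [expansionPoly_zero, expCoeff_zero h0]
    · have hs : ((m : ℂ) + 1) ≠ 0 := by exact_mod_cast m.succ_ne_zero
      have h1 := congrArg (Polynomial.eval (Complex.I * t)) (succ_mul_expansionPoly_succ γ μ m)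
      simp only [Polynomial.eval_mul, Polynomial.eval_add, Polynomial.eval_natCast,
        Polynomial.eval_one, Polynomial.eval_finsetSum, Polynomial.eval_C, Polynomial.eval_pow,
        Polynomial.eval_X] at h1
      refine mul_right_cancel₀ hs (h1.trans ?_)
      rw [mul_assoc, mul_comm (expCoeff _ _ _), succ_mul_expCoeff_succ hρ, Finset.mul_sum]
      refine Finset.sum_congr rfl fun x hx => ?_
      have hx' : x.1 + x.2 = m := Finset.HasAntidiagonal.mem_antidiagonal.1 hx
      rw [ih x.1 (by omega), hγ, mul_pow, ← hx']
      ring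

/-- Taylor's formula for a bounded holomorphic function on a disc. -/
theorem norm_sub_taylor_le {f : ℂ → ℂ} {r R B : ℝ} (hR : 0 < R) (hRr : R < r)
    (hf : DifferentiableOn ℂ f (Metric.ball 0 r)) (hB : ∀ w ∈ Metric.ball (0 : ℂ) r, ‖f w‖ ≤ B)
    (M : ℕ) {w : ℂ} (hw : ‖w‖ ≤ R / 2) :
    ‖f w - ∑ m ∈ Finset.range (M + 1), w ^ m * (iteratedDeriv m f 0 / (m.factorial : ℂ))‖
      ≤ 2 * B * (‖w‖ / R) ^ (M + 1) := by
  have hB0 : 0 ≤ B := (norm_nonneg _).trans (hB 0 (by simp; linarith))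
  have hwr : w ∈ Metric.ball (0 : ℂ) r := by simp; linarith
  have hsum := Complex.hasSum_taylorSeries_on_ball (f := f) (c := 0) (r := r) hf hwr
  set a : ℕ → ℂ := fun n => w ^ n * (iteratedDeriv n f 0 / (n.factorial : ℂ)) with ha
  have hsum' : HasSum a (f w) := by
    refine hsum.congr_fun fun n => ?_
    simp only [ha, smul_eq_mul, sub_zero]; ring
  set q := ‖w‖ / R with hq
  have hq0 : 0 ≤ q := by positivity
  have hq1 : q ≤ 1 / 2 := by rw [hq, div_le_iff₀ hR]; linarith
  have hbound : ∀ n, ‖a n‖ ≤ B * q ^ n := by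
    intro n
    have hc : DiffContOnCl ℂ f (Metric.ball 0 R) :=
      (hf.mono (Metric.closure_ball_subset_closedBall.trans
        (Metric.closedBall_subset_ball hRr))).diffContOnCl
    have h1 := Complex.norm_iteratedDeriv_le_of_forall_mem_sphere_norm_le n hR hc (C := B)
      fun z hz => hB z (Metric.closedBall_subset_ball hRr (Metric.sphere_subset_closedBall hz))
    have hn : (0 : ℝ) < n.factorial := by exact_mod_cast n.factorial_pos
    simp only [ha, norm_mul, norm_pow, norm_div, Complex.norm_natCast]
    calc ‖w‖ ^ n * (‖iteratedDeriv n f 0‖ / n.factorial)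
        ≤ ‖w‖ ^ n * ((n.factorial * B / R ^ n) / n.factorial) := by gcongr
      _ = B * q ^ n := by rw [hq, div_pow]; field_simp
  have htail : HasSum (fun n => a (n + (M + 1))) (f w - ∑ m ∈ Finset.range (M + 1), a m) :=
    (hasSum_nat_add_iff' (M + 1)).2 hsum'
  have hgeo : HasSum (fun n => B * q ^ (M + 1) * q ^ n) (B * q ^ (M + 1) * (1 - q)⁻¹) :=
    (hasSum_geometric_of_lt_one hq0 (by linarith)).mul_left _
  rw [← htail.tsum_eq]
  refine (tsum_of_norm_bounded hgeo fun n => ?_).trans ?_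
  · refine (hbound _).trans (le_of_eq ?_); rw [pow_add]; ring
  · have h2 : (1 - q)⁻¹ ≤ 2 := by
      rw [inv_le_comm₀ (by linarith) (by norm_num)]; linarith
    calc B * q ^ (M + 1) * (1 - q)⁻¹ ≤ B * q ^ (M + 1) * 2 := by gcongr
      _ = 2 * B * q ^ (M + 1) := by ring

end LocalLimit

end

noncomputable section

namespace LocalLimit

theorem one_add_pow_mul_exp_neg_le {μ : ℕ} (hμ : 1 ≤ μ) {c : ℝ} (hc : 0 < c) (A : ℕ) :
    ∃ C, 0 ≤ C ∧ ∀ x : ℝ, 0 ≤ x → Real.exp (-(c * x ^ (2 * μ))) ≤ C / (1 + x) ^ A := by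
  refine ⟨A.factorial / c ^ A * Real.exp (2 * c), by positivity, fun x hx => ?_⟩
  rw [le_div_iff₀ (by positivity)]
  have h1 : x - 1 ≤ x ^ (2 * μ) := by
    rcases le_total x 1 with h | h
    · have : 0 ≤ x ^ (2 * μ) := by positivity
      linarith
    · have : x ^ 1 ≤ x ^ (2 * μ) := pow_le_pow_right₀ h (by omega)
      linarith
  have h2 : (c * (1 + x)) ^ A / A.factorial ≤ Real.exp (c * (1 + x)) :=
    Real.pow_div_factorial_le_exp _ (by positivity) _
  have h3 : (1 + x) ^ A ≤ A.factorial / c ^ A * Real.exp (c * (1 + x)) := by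
    have hf : (0 : ℝ) < A.factorial := by exact_mod_cast A.factorial_pos
    rw [div_le_iff₀ hf, mul_pow] at h2
    rw [div_mul_eq_mul_div, le_div_iff₀ (by positivity)]
    linarith
  calc Real.exp (-(c * x ^ (2 * μ))) * (1 + x) ^ A
      ≤ Real.exp (-(c * (x - 1))) * (A.factorial / c ^ A * Real.exp (c * (1 + x))) := by
        gcongr
    _ = A.factorial / c ^ A * (Real.exp (-(c * (x - 1))) * Real.exp (c * (1 + x))) := by ring
    _ = A.factorial / c ^ A * Real.exp (2 * c) := by
        rw [← Real.exp_add]; congr 2; ring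

theorem norm_pow_sub_norm_pow_le {t : ℂ} (ht : |t.im| ≤ 1) (μ : ℕ) :
    ‖t ^ (2 * μ) - (‖t‖ : ℂ) ^ (2 * μ)‖ ≤ 2 * μ * ‖t‖ ^ (2 * μ - 1) := by
  have h1 : t ^ 2 - (‖t‖ : ℂ) ^ 2 = t * (2 * t.im * Complex.I) := by
    have h := Complex.sub_conj t
    push_cast at h
    rw [← Complex.mul_conj', ← h]; ring
  have h2 : ‖t ^ 2 - (‖t‖ : ℂ) ^ 2‖ ≤ 2 * ‖t‖ := by
    rw [h1, norm_mul, norm_mul, norm_mul, Complex.norm_I, Complex.norm_real, Real.norm_eq_abs]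
    simp only [Complex.norm_ofNat, mul_one]
    nlinarith [norm_nonneg t]
  rcases μ with _ | μ
  · simp
  rw [pow_mul, pow_mul, ← Commute.mul_geom_sum₂ (Commute.all _ _), norm_mul]
  have h3 : ‖∑ i ∈ Finset.range (μ + 1), (t ^ 2) ^ i * ((‖t‖ : ℂ) ^ 2) ^ (μ + 1 - 1 - i)‖
      ≤ (μ + 1) * ‖t‖ ^ (2 * μ) := by
    refine (norm_sum_le_of_le (f := fun i => (t ^ 2) ^ i * ((‖t‖ : ℂ) ^ 2) ^ (μ + 1 - 1 - i))
      _ (n := fun _ => ‖t‖ ^ (2 * μ)) fun i hi => ?_).trans ?_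
    · have hi' : i ≤ μ := Nat.lt_succ_iff.1 (Finset.mem_range.1 hi)
      simp only [norm_mul, norm_pow, Complex.norm_real, norm_norm]
      rw [← pow_mul, ← pow_mul, ← pow_add]
      refine le_of_eq ?_
      congr 1; omega
    · simp
  calc _ ≤ 2 * ‖t‖ * ((μ + 1) * ‖t‖ ^ (2 * μ)) := by gcongr
    _ = 2 * ((μ + 1 : ℕ) : ℝ) * ‖t‖ ^ (2 * (μ + 1) - 1) := by
        rw [show 2 * (μ + 1) - 1 = 2 * μ + 1 by omega, pow_succ]; push_cast; ring

theorem norm_exp_neg_mul_pow_le {μ : ℕ} (hμ : 1 ≤ μ) {β : ℂ} (hβ : 0 < β.re) :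
    ∃ C, 0 ≤ C ∧ ∀ t : ℂ, |t.im| ≤ 1 →
      ‖Complex.exp (-β * t ^ (2 * μ))‖ ≤ C * Real.exp (-(β.re / 2 * ‖t‖ ^ (2 * μ))) := by
  set c := β.re with hc
  set L := ‖β‖ * (2 * μ) with hL
  have hL0 : 0 ≤ L := by positivity
  set T := 2 * L / c with hT
  have hT0 : 0 ≤ T := by positivity
  refine ⟨Real.exp (L * T ^ (2 * μ - 1)), (Real.exp_pos _).le, fun t ht => ?_⟩
  rw [Complex.norm_exp, ← Real.exp_add]
  refine Real.exp_le_exp.2 ?_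
  set τ := ‖t‖ with hτ
  have hτ0 : 0 ≤ τ := norm_nonneg t
  have h1 : (-β * t ^ (2 * μ)).re = -(c * τ ^ (2 * μ)) + (-β * (t ^ (2 * μ) - (τ : ℂ) ^ (2 * μ))).re := by
    have : -β * t ^ (2 * μ) = -β * ((τ ^ (2 * μ) : ℝ) : ℂ)
        + -β * (t ^ (2 * μ) - (τ : ℂ) ^ (2 * μ)) := by push_cast; ring
    rw [this, Complex.add_re, Complex.re_mul_ofReal, Complex.neg_re]; ring
  have h2 : (-β * (t ^ (2 * μ) - (τ : ℂ) ^ (2 * μ))).re ≤ L * τ ^ (2 * μ - 1) := by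
    refine (Complex.re_le_norm _).trans ?_
    rw [norm_mul, norm_neg, hL, mul_assoc]
    exact mul_le_mul_of_nonneg_left (norm_pow_sub_norm_pow_le ht μ) (norm_nonneg _)
  have h3 : L * τ ^ (2 * μ - 1) ≤ c / 2 * τ ^ (2 * μ) + L * T ^ (2 * μ - 1) := by
    have e : τ ^ (2 * μ) = τ * τ ^ (2 * μ - 1) := by
      rw [← pow_succ']; congr 1; omega
    rcases le_total τ T with h | h
    · have : τ ^ (2 * μ - 1) ≤ T ^ (2 * μ - 1) := pow_le_pow_left₀ hτ0 h _
      have h5 : 0 ≤ c / 2 * τ ^ (2 * μ) := by positivity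
      have := mul_le_mul_of_nonneg_left this hL0
      linarith
    · have h4 : L ≤ c / 2 * τ := by
        rw [hT, div_le_iff₀ hβ] at h; linarith
      have h5 : 0 ≤ L * T ^ (2 * μ - 1) := by positivity
      have h6 : 0 ≤ τ ^ (2 * μ - 1) := by positivity
      rw [e]
      nlinarith
  linarith

theorem norm_eval_le (Q : ℂ[X]) : ∃ C, 0 ≤ C ∧ ∀ t : ℂ,
    ‖Q.eval (Complex.I * t)‖ ≤ C * (1 + ‖t‖) ^ Q.natDegree := by
  refine ⟨∑ i ∈ Finset.range (Q.natDegree + 1), ‖Q.coeff i‖, by positivity, fun t => ?_⟩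
  rw [Polynomial.eval_eq_sum_range, Finset.sum_mul]
  refine norm_sum_le_of_le _ fun i hi => ?_
  have hi' : i ≤ Q.natDegree := Nat.lt_succ_iff.1 (Finset.mem_range.1 hi)
  rw [norm_mul, norm_pow, norm_mul, Complex.norm_I, one_mul]
  have h1 : ‖t‖ ^ i ≤ (1 + ‖t‖) ^ i := by gcongr; linarith [norm_nonneg t]
  have h2 : (1 + ‖t‖) ^ i ≤ (1 + ‖t‖) ^ Q.natDegree :=
    pow_le_pow_right₀ (by linarith [norm_nonneg t]) hi'
  gcongr
  exact h1.trans h2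

theorem abs_im_le_of_mem_closedBall {t η : ℝ} (hη : η ≤ 1) {ζ : ℂ}
    (hζ : ζ ∈ Metric.closedBall (t : ℂ) η) : |ζ.im| ≤ 1 ∧ 1 + |t| ≤ 2 * (1 + ‖ζ‖) := by
  rw [mem_closedBall_iff_norm] at hζ
  constructor
  · have := Complex.abs_im_le_norm (ζ - t)
    simp at this
    linarith
  · have h1 : ‖(t : ℂ)‖ ≤ ‖ζ‖ + ‖ζ - t‖ := by
      have := norm_sub_le ζ (ζ - t)
      simpa using this
    rw [Complex.norm_real, Real.norm_eq_abs] at h1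
    linarith [norm_nonneg ζ]

theorem div_one_add_norm_pow_le {t η C : ℝ} (hη : η ≤ 1) (hC : 0 ≤ C) (A : ℕ) {ζ : ℂ}
    (hζ : ζ ∈ Metric.closedBall (t : ℂ) η) :
    C / (1 + ‖ζ‖) ^ A ≤ C * 2 ^ A / (1 + |t|) ^ A := by
  have h := (abs_im_le_of_mem_closedBall hη hζ).2
  have h0 := norm_nonneg ζ
  have h1 := abs_nonneg t
  rw [div_le_div_iff₀ (by positivity) (by positivity), mul_assoc, ← mul_pow]
  gcongr

theorem C2BoundAt_eval_mul_exp {μ : ℕ} (hμ : 1 ≤ μ) {β : ℂ} (hβ : 0 < β.re) (Q : ℂ[X]) (A : ℕ) :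
    ∃ B, 0 ≤ B ∧ ∀ t : ℝ, C2BoundAt
      (fun x : ℝ => Q.eval (Complex.I * x) * Complex.exp (-β * (x : ℂ) ^ (2 * μ)))
      (B / (1 + |t|) ^ A) t := by
  obtain ⟨C1, hC1, h1⟩ := norm_exp_neg_mul_pow_le hμ hβ
  obtain ⟨C2, hC2, h2⟩ := one_add_pow_mul_exp_neg_le hμ (half_pos hβ) (A + Q.natDegree)
  obtain ⟨C3, hC3, h3⟩ := norm_eval_le Q
  refine ⟨2 * (C3 * (C1 * C2) * 2 ^ A), by positivity, fun t => ?_⟩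
  have hd : Differentiable ℂ fun z : ℂ =>
      Q.eval (Complex.I * z) * Complex.exp (-β * z ^ (2 * μ)) := by fun_prop
  refine (C2BoundAt.of_holomorphic (b := C3 * (C1 * C2) * 2 ^ A / (1 + |t|) ^ A) isOpen_univ
    hd.differentiableOn one_pos le_rfl
    (Set.subset_univ _) fun ζ hζ => ?_).mono (le_of_eq (by ring))
  refine le_trans ?_ (div_one_add_norm_pow_le le_rfl (by positivity) A hζ)
  have hn := norm_nonneg ζ
  rw [norm_mul]
  calc _ ≤ (C3 * (1 + ‖ζ‖) ^ Q.natDegree) * (C1 * (C2 / (1 + ‖ζ‖) ^ (A + Q.natDegree))) := by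
        gcongr
        · exact h3 ζ
        · exact (h1 ζ (abs_im_le_of_mem_closedBall le_rfl hζ).1).trans
            (mul_le_mul_of_nonneg_left (h2 _ hn) hC1)
    _ = C3 * (C1 * C2) / (1 + ‖ζ‖) ^ A := by
        rw [pow_add]; field_simp

theorem inv_one_add_abs_sq_le (t : ℝ) : 1 / (1 + |t|) ^ 2 ≤ (1 + t ^ 2)⁻¹ := by
  rw [← one_div]
  refine one_div_le_one_div_of_le (by positivity) ?_
  nlinarith [abs_nonneg t, sq_abs t]

theorem exists_forall_le_two_le {ι : Type*} {f : ℕ → ι → ℝ} (h : ∀ j ≤ 2, ∃ C, ∀ i, f j i ≤ C) :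
    ∃ C, 0 ≤ C ∧ ∀ j ≤ 2, ∀ i, f j i ≤ C := by
  obtain ⟨C0, h0⟩ := h 0 (by norm_num)
  obtain ⟨C1, h1⟩ := h 1 (by norm_num)
  obtain ⟨C2, h2⟩ := h 2 (by norm_num)
  refine ⟨|C0| + |C1| + |C2|, by positivity, fun j hj i => ?_⟩
  have a0 := abs_nonneg C0; have a1 := abs_nonneg C1; have a2 := abs_nonneg C2
  interval_cases j
  · linarith [h0 i, le_abs_self C0]
  · linarith [h1 i, le_abs_self C1]
  · linarith [h2 i, le_abs_self C2]

theorem exists_iteratedDeriv_cutoff_le {χ : ℝ → ℂ} (hχ : ContDiff ℝ 2 χ) {r : ℝ}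
    (hout : ∀ θ, r ≤ |θ| → χ θ = 0) :
    ∃ C, 0 ≤ C ∧ ∀ j ≤ 2, ∀ θ, ‖iteratedDeriv j χ θ‖ ≤ C := by
  have hcs : HasCompactSupport χ := by
    refine HasCompactSupport.intro (isCompact_Icc (a := -r) (b := r)) fun θ hθ => hout θ ?_
    by_contra h
    exact hθ (abs_le.1 (not_le.1 h).le)
  have h : ∀ j ≤ 2, ∃ C, ∀ θ, ‖iteratedDeriv j χ θ‖ ≤ C := fun j hj => by
    have hc : Continuous (iteratedDeriv j χ) := hχ.continuous_iteratedDeriv j (by exact_mod_cast hj)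
    have hs : HasCompactSupport (iteratedDeriv j χ) := by
      have := hcs.iteratedFDeriv (𝕜 := ℝ) j
      refine this.mono fun x hx => ?_
      rw [Function.mem_support, ← norm_ne_zero_iff, norm_iteratedFDeriv_eq_norm_iteratedDeriv,
        norm_ne_zero_iff]
      exact hx
    exact hc.bounded_above_of_compact_support hs
  exact exists_forall_le_two_le h

theorem exists_iteratedDeriv_one_sub_cutoff_le {χ : ℝ → ℂ} (hχ : ContDiff ℝ 2 χ) {r δ : ℝ}
    (hδ : 0 < δ) (hin : ∀ θ, |θ| ≤ δ → χ θ = 1) (hout : ∀ θ, r ≤ |θ| → χ θ = 0) (A : ℕ) :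
    ∃ C, 0 ≤ C ∧ ∀ j ≤ 2, ∀ θ, ‖iteratedDeriv j (fun x => 1 - χ x) θ‖ ≤ C * |θ| ^ A := by
  obtain ⟨K, hK0, hK⟩ := exists_iteratedDeriv_cutoff_le hχ hout
  refine ⟨(1 + K) / δ ^ A, by positivity, fun j hj θ => ?_⟩
  rcases lt_or_ge |θ| δ with h | h
  · have hev : (fun x => 1 - χ x) =ᶠ[𝓝 θ] fun _ => 0 := by
      filter_upwards [(continuous_abs.tendsto θ).eventually_lt_const h] with x hx
      rw [hin x hx.le, sub_self]
    rw [hev.iteratedDeriv_eq]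
    simp only [iteratedDeriv_const, ite_self, norm_zero]
    positivity
  · have h1 : ‖iteratedDeriv j (fun x => 1 - χ x) θ‖ ≤ 1 + K := by
      rcases j with _ | j
      · simpa using (norm_sub_le (1 : ℂ) (χ θ)).trans
          (add_le_add (by simp) (by simpa using hK 0 (by norm_num) θ))
      · rw [iteratedDeriv_const_sub (by omega), iteratedDeriv_neg, norm_neg]
        linarith [hK (j + 1) hj θ]
    have h2 : δ ^ A ≤ |θ| ^ A := pow_le_pow_left₀ hδ.le h A
    rw [div_mul_eq_mul_div, le_div_iff₀ (by positivity)]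
    gcongr

end LocalLimit

end

noncomputable section

namespace LocalLimit

theorem C2BoundAt_sum_mul {μ : ℕ} (hμ : 1 ≤ μ) {β : ℂ} (hβ : 0 < β.re) (P : ℕ → ℂ[X]) (A M : ℕ) :
    ∃ B, 0 ≤ B ∧ ∀ z : ℝ, 0 < z → z ≤ 1 → ∀ t : ℝ, C2BoundAt
      (fun x : ℝ => ∑ m ∈ Finset.range M, (z : ℂ) ^ m *
        ((P m).eval (Complex.I * x) * Complex.exp (-β * (x : ℂ) ^ (2 * μ))))
      (B / (1 + |t|) ^ A) t := by
  induction M with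
  | zero =>
    refine ⟨0, le_rfl, fun z _ _ t => ?_⟩
    simp only [Finset.range_zero, Finset.sum_empty]
    exact C2BoundAt.of_eventuallyEq_zero (EventuallyEq.refl _ _) (by simp)
  | succ M ih =>
    obtain ⟨B, hB, h⟩ := ih
    obtain ⟨B', hB', h'⟩ := C2BoundAt_eval_mul_exp hμ hβ (P M) A
    refine ⟨B + 4 * B', by positivity, fun z hz hz1 t => ?_⟩
    simp only [Finset.sum_range_succ]
    have hc : C2BoundAt (fun _ : ℝ => (z : ℂ) ^ M) 1 t := by
      refine ⟨contDiffAt_const, fun j _ => ?_⟩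
      have h1 : ‖(z : ℂ) ^ M‖ ≤ 1 := by
        rw [norm_pow, Complex.norm_real, Real.norm_of_nonneg hz.le]
        exact pow_le_one₀ hz.le hz1
      rcases j with _ | j
      · simpa using h1
      · simp [iteratedDeriv_const]
    refine ((h z hz hz1 t).add (hc.mul (h' t))).mono (le_of_eq ?_)
    ring

/-- Uniform bound, in rescaled Fourier variables, for the remainder of the asymptotic expansion
near a tangency point. -/
theorem exists_remainder_bound {μ : ℕ} (hμ : 1 ≤ μ) {β : ℂ} (hβ : 0 < β.re) {ρ : ℂ → ℂ}
    (hρ : AnalyticAt ℂ ρ 0) (h0 : ρ 0 = 0) {P : ℕ → ℂ[X]}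
    (hP : ∀ t m, (P m).eval (Complex.I * t) = t ^ m * expCoeff ρ (t ^ (2 * μ)) m) (M : ℕ) :
    ∃ r₀ > 0, ∀ χ : ℝ → ℂ, ContDiff ℝ 2 χ → (∃ δ > 0, ∀ θ, |θ| ≤ δ → χ θ = 1) →
      (∀ θ, r₀ ≤ |θ| → χ θ = 0) → ∃ C, 0 ≤ C ∧ ∀ z : ℝ, 0 < z → z ≤ 1 → ∀ t : ℝ, C2BoundAt
        (fun x : ℝ => χ (z * x) *
          Complex.exp (-β * (x : ℂ) ^ (2 * μ) + (x : ℂ) ^ (2 * μ) * ρ (z * x)) -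
          ∑ m ∈ Finset.range (M + 1), (z : ℂ) ^ m *
            ((P m).eval (Complex.I * x) * Complex.exp (-β * (x : ℂ) ^ (2 * μ))))
        (C * z ^ (M + 1) * (1 + t ^ 2)⁻¹) t := by
  set c := β.re with hc
  obtain ⟨r, hr, hρd, hρb⟩ : ∃ r > 0, DifferentiableOn ℂ ρ (Metric.ball 0 r) ∧
      ∀ w ∈ Metric.ball (0 : ℂ) r, ‖ρ w‖ ≤ c / 4 := by
    have h1 : ∀ᶠ w in 𝓝 (0 : ℂ), ‖ρ w‖ < c / 4 :=
      hρ.continuousAt.norm.eventually_lt_const (by simpa [h0] using hβ)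
    obtain ⟨r, hr, h⟩ := Metric.eventually_nhds_iff_ball.1 (h1.and hρ.eventually_analyticAt)
    exact ⟨r, hr, fun w hw => (h w hw).2.differentiableAt.differentiableWithinAt,
      fun w hw => (h w hw).1.le⟩
  refine ⟨r / 8, by positivity, fun χ hχ ⟨δ, hδ, hin⟩ hout => ?_⟩
  obtain ⟨Kχ, hKχ, hχb⟩ := exists_iteratedDeriv_cutoff_le hχ hout
  obtain ⟨Kψ, hKψ, hψb⟩ := exists_iteratedDeriv_one_sub_cutoff_le hχ hδ hin hout (M + 1)
  obtain ⟨B, hB, hS⟩ := C2BoundAt_sum_mul hμ hβ P (M + 3) (M + 1)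
  obtain ⟨C1, hC1, h1⟩ := norm_exp_neg_mul_pow_le hμ hβ
  obtain ⟨C2, hC2, h2⟩ := one_add_pow_mul_exp_neg_le hμ (c := c / 4) (by positivity) (M + 3)
  set η := min 1 (r / 8) with hη
  have hη0 : 0 < η := by positivity
  have hη1 : η ≤ 1 := min_le_left _ _
  have hηr : η ≤ r / 8 := min_le_right _ _
  set CA := 2 * C1 * C2 / (r / 2) ^ (M + 1) with hCA
  have hCA0 : 0 ≤ CA := by positivity
  refine ⟨4 * (Kχ * (2 * (CA * 2 ^ 2) / η ^ 2)) + 4 * (Kψ * B), by positivity,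
    fun z hz hz1 t => ?_⟩
  have hzabs : |z| ≤ 1 := by rwa [abs_of_pos hz]
  have hznorm : ‖(z : ℂ)‖ = z := by rw [Complex.norm_real, Real.norm_of_nonneg hz.le]
  set S : ℂ → ℂ := fun x => ∑ m ∈ Finset.range (M + 1), (z : ℂ) ^ m *
    ((P m).eval (Complex.I * x) * Complex.exp (-β * x ^ (2 * μ))) with hSdef
  set A : ℂ → ℂ := fun x =>
    Complex.exp (-β * x ^ (2 * μ) + x ^ (2 * μ) * ρ (z * x)) - S x with hAdef
  have hSd : Differentiable ℂ S := by
    refine Differentiable.fun_sum fun m _ => ?_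
    fun_prop
  have hAbound : ∀ x : ℂ, |x.im| ≤ 1 → ‖z * x‖ ≤ r / 4 →
      ‖A x‖ ≤ CA * z ^ (M + 1) / (1 + ‖x‖) ^ 2 := by
    intro x hx hzx
    set s := x ^ (2 * μ) with hs
    have hsn : ‖s‖ = ‖x‖ ^ (2 * μ) := norm_pow _ _
    have hA : A x = Complex.exp (-β * s) * (Complex.exp (s * ρ (z * x)) -
        ∑ m ∈ Finset.range (M + 1), (z * x) ^ m *
          (iteratedDeriv m (fun w => Complex.exp (s * ρ w)) 0 / (m.factorial : ℂ))) := by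
      simp only [hAdef, hSdef, Complex.exp_add, mul_sub, Finset.mul_sum]
      congr 1
      refine Finset.sum_congr rfl fun m _ => ?_
      rw [hP, expCoeff, mul_pow]
      ring
    have hT := norm_sub_taylor_le (f := fun w => Complex.exp (s * ρ w)) (r := r) (R := r / 2)
      (B := Real.exp (c / 4 * ‖x‖ ^ (2 * μ))) (by positivity) (by linarith)
      (hρd.const_mul s).cexp (fun w hw => by
        rw [Complex.norm_exp]
        refine Real.exp_le_exp.2 ((Complex.re_le_norm _).trans ?_)
        rw [norm_mul, hsn, mul_comm]
        exact mul_le_mul_of_nonneg_right (hρb w hw) (by positivity)) M (w := z * x)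
      (by linarith)
    have hxn := norm_nonneg x
    rw [hA, norm_mul]
    calc _ ≤ (C1 * Real.exp (-(c / 2 * ‖x‖ ^ (2 * μ)))) *
          (2 * Real.exp (c / 4 * ‖x‖ ^ (2 * μ)) * (‖z * x‖ / (r / 2)) ^ (M + 1)) := by
          gcongr
          exact h1 x hx
      _ = 2 * C1 * (z * ‖x‖ / (r / 2)) ^ (M + 1) *
          (Real.exp (-(c / 2 * ‖x‖ ^ (2 * μ))) * Real.exp (c / 4 * ‖x‖ ^ (2 * μ))) := by
          rw [norm_mul, hznorm]; ring
      _ = 2 * C1 * (z * ‖x‖ / (r / 2)) ^ (M + 1) * Real.exp (-(c / 4 * ‖x‖ ^ (2 * μ))) := by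
          rw [← Real.exp_add]; congr 2; ring
      _ ≤ 2 * C1 * (z * (1 + ‖x‖) / (r / 2)) ^ (M + 1) * (C2 / (1 + ‖x‖) ^ (M + 3)) := by
          gcongr
          · linarith
          · exact h2 _ hxn
      _ = CA * z ^ (M + 1) / (1 + ‖x‖) ^ 2 := by
          rw [hCA, div_pow, mul_pow, show M + 3 = (M + 1) + 2 by ring, pow_add _ (M + 1) 2]
          field_simp
  have hA2 : C2BoundAt (fun x : ℝ => χ (z * x) * A x)
      (4 * (Kχ * (2 * (CA * 2 ^ 2) / η ^ 2)) * z ^ (M + 1) * (1 + t ^ 2)⁻¹) t := by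
    rcases le_or_gt |z * t| (r / 8) with h | h
    · set U : Set ℂ := {x | ‖z * x‖ < r} with hU
      have hUo : IsOpen U := isOpen_lt (by fun_prop) continuous_const
      have hmem : ∀ ζ ∈ Metric.closedBall (t : ℂ) η, ‖z * ζ‖ ≤ r / 4 := by
        intro ζ hζ
        rw [mem_closedBall_iff_norm] at hζ
        have e : (z : ℂ) * ζ = ((z * t : ℝ) : ℂ) + z * (ζ - t) := by push_cast; ring
        have h3 : ‖(z : ℂ) * (ζ - t)‖ ≤ r / 8 := by
          rw [norm_mul, hznorm]
          nlinarith [norm_nonneg (ζ - t)]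
        rw [e]
        refine (norm_add_le _ _).trans ?_
        rw [Complex.norm_real, Real.norm_eq_abs]
        linarith
      have hAd : DifferentiableOn ℂ A U := by
        have : DifferentiableOn ℂ (fun x : ℂ => ρ (z * x)) U :=
          hρd.comp (g := ρ) (f := fun x : ℂ => (z : ℂ) * x) (by fun_prop) fun x hx => by
            simpa [hU] using hx
        exact ((DifferentiableOn.add (by fun_prop)
          (DifferentiableOn.mul (by fun_prop) this)).cexp).sub hSd.differentiableOn
      have hC := C2BoundAt.of_holomorphic (b := CA * z ^ (M + 1) * 2 ^ 2 / (1 + |t|) ^ 2)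
        hUo hAd hη0 hη1 (fun ζ hζ => (hmem ζ hζ).trans_lt (by linarith)) fun ζ hζ =>
          (hAbound ζ (abs_im_le_of_mem_closedBall hη1 hζ).1 (hmem ζ hζ)).trans
            (div_one_add_norm_pow_le hη1 (by positivity) 2 hζ)
      have hχc : C2BoundAt (fun x => χ (z * x)) Kχ t :=
        C2BoundAt.comp_mul hχ hzabs fun j hj => hχb j hj _
      refine (hχc.mul hC).mono ?_
      calc 4 * (Kχ * (2 * (CA * z ^ (M + 1) * 2 ^ 2 / (1 + |t|) ^ 2) / η ^ 2))
          = 4 * (Kχ * (2 * (CA * 2 ^ 2) / η ^ 2)) * z ^ (M + 1) * (1 / (1 + |t|) ^ 2) := by ring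
        _ ≤ _ := by
          gcongr
          exact inv_one_add_abs_sq_le t
    · refine C2BoundAt.of_eventuallyEq_zero ?_ (by positivity)
      have hcont : Continuous fun x : ℝ => |z * x| := by fun_prop
      filter_upwards [(hcont.tendsto t).eventually_const_lt h] with x hx
      rw [hout _ hx.le, zero_mul]
  have hψ2 : C2BoundAt (fun x : ℝ => (1 - χ (z * x)) * S x)
      (4 * (Kψ * B) * z ^ (M + 1) * (1 + t ^ 2)⁻¹) t := by
    have hψc : C2BoundAt (fun x => 1 - χ (z * x)) (Kψ * |z * t| ^ (M + 1)) t :=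
      C2BoundAt.comp_mul (f := fun x => 1 - χ x) (contDiff_const.sub hχ) hzabs
        fun j hj => hψb j hj _
    refine (hψc.mul (hS z hz hz1 t)).mono ?_
    have ht0 := abs_nonneg t
    have h3 : |t| ^ (M + 1) / (1 + |t|) ^ (M + 3) ≤ 1 / (1 + |t|) ^ 2 := by
      rw [div_le_div_iff₀ (by positivity) (by positivity), one_mul,
        show M + 3 = (M + 1) + 2 by ring, pow_add _ (M + 1) 2]
      gcongr
      linarith
    calc 4 * (Kψ * |z * t| ^ (M + 1) * (B / (1 + |t|) ^ (M + 3)))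
        = 4 * (Kψ * B) * z ^ (M + 1) * (|t| ^ (M + 1) / (1 + |t|) ^ (M + 3)) := by
          rw [abs_mul, abs_of_pos hz]; ring
      _ ≤ _ := by
        gcongr
        exact h3.trans (inv_one_add_abs_sq_le t)
  have hfun : (fun x : ℝ => χ (z * x) *
          Complex.exp (-β * (x : ℂ) ^ (2 * μ) + (x : ℂ) ^ (2 * μ) * ρ (z * x)) -
          ∑ m ∈ Finset.range (M + 1), (z : ℂ) ^ m *
            ((P m).eval (Complex.I * x) * Complex.exp (-β * (x : ℂ) ^ (2 * μ))))
      = fun x : ℝ => χ (z * x) * A x - (1 - χ (z * x)) * S x := by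
    funext x
    simp only [hAdef, hSdef]
    ring
  rw [hfun]
  refine (hA2.sub hψ2).mono (le_of_eq ?_)
  ring

end LocalLimit

end

noncomputable section

namespace LocalLimit

section Attractor

open MeasureTheory FourierTransform

variable {μ : ℕ} {β : ℂ}

theorem integrable_exp_mul {f : ℝ → ℂ} (hf : Integrable f) (x : ℝ) :
    Integrable fun t : ℝ => Complex.exp (-Complex.I * x * t) * f t := by
  refine hf.bdd_mul (c := 1) (Continuous.aestronglyMeasurable (by fun_prop))
    (Eventually.of_forall fun t => le_of_eq ?_)
  have : -Complex.I * x * t = ((-(x * t) : ℝ) : ℂ) * Complex.I := by push_cast; ring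
  rw [this, Complex.norm_exp_ofReal_mul_I]

theorem exists_C2BoundAt_eval_mul_exp (hμ : 1 ≤ μ) (hβ : 0 < β.re) (Q : ℂ[X]) :
    ∃ B, 0 ≤ B ∧ ∀ t : ℝ, C2BoundAt
      (fun x : ℝ => Q.eval (Complex.I * x) * Complex.exp (-β * (x : ℂ) ^ (2 * μ)))
      (B * (1 + t ^ 2)⁻¹) t := by
  obtain ⟨B, hB, h⟩ := C2BoundAt_eval_mul_exp hμ hβ Q 2
  refine ⟨B, hB, fun t => (h t).mono ?_⟩
  rw [div_eq_mul_one_div]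
  gcongr
  exact inv_one_add_abs_sq_le t

theorem integrable_eval_mul_exp (hμ : 1 ≤ μ) (hβ : 0 < β.re) (Q : ℂ[X]) :
    Integrable fun x : ℝ => Q.eval (Complex.I * x) * Complex.exp (-β * (x : ℂ) ^ (2 * μ)) := by
  obtain ⟨B, _, h⟩ := exists_C2BoundAt_eval_mul_exp hμ hβ Q
  simpa using (integrable_iteratedDeriv_of_C2BoundAt h (j := 0) (by norm_num)).1

theorem attractor_eq_fourier (x : ℝ) :
    attractor μ β x = 1 / (2 * (Real.pi : ℂ)) *
      𝓕 (fun t : ℝ => Complex.exp (-β * (t : ℂ) ^ (2 * μ))) ((2 * Real.pi)⁻¹ * x) := by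
  rw [attractor, inv_mul_eq_div, fourier_eq_integral_exp]

theorem iteratedDeriv_attractor (hμ : 1 ≤ μ) (hβ : 0 < β.re) (j : ℕ) (x : ℝ) :
    iteratedDeriv j (attractor μ β) x = 1 / (2 * (Real.pi : ℂ)) *
      ∫ t : ℝ, Complex.exp (-Complex.I * x * t) *
        ((-(Complex.I * t)) ^ j * Complex.exp (-β * (t : ℂ) ^ (2 * μ))) := by
  set f : ℝ → ℂ := fun t : ℝ => Complex.exp (-β * (t : ℂ) ^ (2 * μ)) with hf
  have hint : ∀ n : ℕ, Integrable fun t : ℝ => t ^ n • f t := fun n => by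
    have := integrable_eval_mul_exp hμ hβ ((Polynomial.C (-Complex.I) * Polynomial.X) ^ n)
    refine this.congr (Eventually.of_forall fun t => ?_)
    simp only [Polynomial.eval_pow, Polynomial.eval_mul, Polynomial.eval_C, Polynomial.eval_X,
      Complex.real_smul, hf]
    rw [← mul_assoc, neg_mul, Complex.I_mul_I, neg_neg, one_mul, Complex.ofReal_pow]
  have hcd : ContDiff ℝ j (𝓕 f) := by
    refine Real.contDiff_fourier (N := j) fun n _ => ?_
    simpa [norm_smul] using (hint n).norm
  have h1 : attractor μ β = fun x =>
      1 / (2 * (Real.pi : ℂ)) * 𝓕 f ((2 * Real.pi)⁻¹ * x) := funext attractor_eq_fourier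
  have hpi : (Real.pi : ℂ) ≠ 0 := by exact_mod_cast Real.pi_ne_zero
  rw [h1, iteratedDeriv_const_mul_field, iteratedDeriv_comp_const_smul hcd,
    Real.iteratedDeriv_fourier (N := ⊤) (fun n _ => hint n) le_top]
  simp only
  rw [inv_mul_eq_div, fourier_eq_integral_exp, ← integral_smul]
  congr 1
  refine integral_congr_ae (Eventually.of_forall fun t => ?_)
  simp only [Complex.real_smul, smul_eq_mul, Complex.ofReal_pow, Complex.ofReal_inv,
    Complex.ofReal_mul, Complex.ofReal_ofNat]
  have e : (-(Complex.I * t)) ^ j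
      = ((2 * (Real.pi : ℂ))⁻¹) ^ j * (-2 * Real.pi * Complex.I * t) ^ j := by
    rw [← mul_pow]; congr 1; field_simp
  rw [e]; ring

theorem applyNegDeriv_attractor (hμ : 1 ≤ μ) (hβ : 0 < β.re) (Q : ℂ[X]) (x : ℝ) :
    applyNegDeriv Q (attractor μ β) x = 1 / (2 * (Real.pi : ℂ)) *
      ∫ t : ℝ, Complex.exp (-Complex.I * x * t) *
        (Q.eval (Complex.I * t) * Complex.exp (-β * (t : ℂ) ^ (2 * μ))) := by
  have hint : ∀ (j : ℕ) (c : ℂ), Integrable fun t : ℝ => Complex.exp (-Complex.I * x * t) *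
      (c * (Complex.I * t) ^ j * Complex.exp (-β * (t : ℂ) ^ (2 * μ))) := fun j c => by
    refine integrable_exp_mul ?_ x
    refine (integrable_eval_mul_exp hμ hβ (Polynomial.C c * Polynomial.X ^ j)).congr
      (Eventually.of_forall fun t => ?_)
    simp
  simp only [applyNegDeriv, Polynomial.sum_def, Polynomial.eval_eq_sum, Finset.sum_mul,
    Finset.mul_sum]
  rw [integral_finsetSum _ fun j _ => hint j _, Finset.mul_sum]
  refine Finset.sum_congr rfl fun j _ => ?_
  rw [iteratedDeriv_attractor hμ hβ, mul_left_comm, ← integral_const_mul]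
  congr 1
  refine integral_congr_ae (Eventually.of_forall fun t => ?_)
  simp only
  rw [neg_pow (Complex.I * (t : ℂ))]
  have : ((-1 : ℂ) ^ j) * (-1) ^ j = 1 := by rw [← mul_pow]; simp
  linear_combination (Q.coeff j * Complex.exp (-Complex.I * x * t) * (Complex.I * t) ^ j *
    Complex.exp (-β * (t : ℂ) ^ (2 * μ))) * this

theorem applyNegDeriv_one (f : ℝ → ℂ) : applyNegDeriv 1 f = f := by
  funext x
  rw [applyNegDeriv, ← Polynomial.C_1, Polynomial.sum_C_index] <;> simp

theorem scaledProfile_eq (a : ℤ → ℂ) (κ : ℂ) (α : ℝ) (hμ : 1 ≤ μ) (hβ : 0 < β.re) (m n : ℕ)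
    (Q : ℂ[X]) (l : ℤ) :
    scaledProfile a κ α μ m n (applyNegDeriv Q (attractor μ β)) l =
      κ ^ (-l) * symbol a κ ^ n * ((((n : ℝ) ^ (1 / (2 * (μ : ℝ))))⁻¹ : ℝ) : ℂ) ^ (m + 1) *
        (1 / (2 * (Real.pi : ℂ)) * ∫ t : ℝ, Complex.exp (-Complex.I *
          ((((l : ℝ) - α * n) / (n : ℝ) ^ (1 / (2 * (μ : ℝ))) : ℝ) : ℂ) * t) *
          (Q.eval (Complex.I * t) * Complex.exp (-β * (t : ℂ) ^ (2 * μ)))) := by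
  rw [scaledProfile, applyNegDeriv_attractor hμ hβ]
  congr 1
  rw [div_eq_mul_inv]
  congr 1
  rw [← Complex.ofReal_pow, ← Complex.ofReal_inv, inv_pow, ← Real.rpow_natCast,
    ← Real.rpow_mul (Nat.cast_nonneg n)]
  congr 4
  push_cast
  ring

theorem exists_norm_scaledProfile_le {a : ℤ → ℂ} {κ : ℂ} (hκ : ‖κ‖ = 1) (hF : ‖symbol a κ‖ = 1)
    (α : ℝ) (hμ : 1 ≤ μ) (hβ : 0 < β.re) (m n : ℕ) (Q : ℂ[X]) :
    ∃ C, ∀ l, ‖scaledProfile a κ α μ m n (applyNegDeriv Q (attractor μ β)) l‖ ≤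
      C * (1 + (((l : ℝ) - α * n) / (n : ℝ) ^ (1 / (2 * (μ : ℝ)))) ^ 2)⁻¹ := by
  obtain ⟨B, hB, h⟩ := exists_C2BoundAt_eval_mul_exp hμ hβ Q
  refine ⟨(((n : ℝ) ^ (1 / (2 * (μ : ℝ))))⁻¹) ^ (m + 1) * (1 / (2 * Real.pi) *
    (2 * Real.pi * B)), fun l => ?_⟩
  rw [scaledProfile_eq a κ α hμ hβ]
  simp only [norm_mul, norm_zpow, norm_pow, hκ, hF, one_zpow, one_pow, one_mul, norm_div, norm_one,
    Complex.norm_real, Complex.norm_ofNat, norm_inv, Real.norm_of_nonneg Real.pi_pos.le,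
    Real.norm_of_nonneg (Real.rpow_nonneg (Nat.cast_nonneg n) (1 / (2 * (μ : ℝ))))]
  rw [mul_assoc, mul_assoc (1 / (2 * Real.pi))]
  gcongr
  exact norm_integral_exp_mul_le h _

theorem one_le_rpow_scale {n : ℕ} (hn : 1 ≤ n) (μ : ℕ) :
    1 ≤ (n : ℝ) ^ (1 / (2 * (μ : ℝ))) :=
  Real.one_le_rpow (by exact_mod_cast hn) (by positivity)

theorem summable_norm_scaledProfile {a : ℤ → ℂ} {κ : ℂ} (hκ : ‖κ‖ = 1) (hF : ‖symbol a κ‖ = 1)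
    (α : ℝ) (hμ : 1 ≤ μ) (hβ : 0 < β.re) (m : ℕ) {n : ℕ} (hn : 1 ≤ n) (Q : ℂ[X]) :
    Summable fun l => ‖scaledProfile a κ α μ m n (applyNegDeriv Q (attractor μ β)) l‖ := by
  obtain ⟨C, hC⟩ := exists_norm_scaledProfile_le hκ hF α hμ hβ m n Q
  exact Summable.of_nonneg_of_le (fun _ => norm_nonneg _) hC
    ((summable_inv_one_add_sq_and_tsum_le (one_le_rpow_scale hn μ) _).1.mul_left C)

end Attractor

section Expansion

/-- An analytic function that is `O(z ^ n)` at `0` is divisible by `z ^ n` there. -/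
theorem exists_eventuallyEq_pow_mul_of_isBigO {f : ℂ → ℂ} (hf : AnalyticAt ℂ f 0) {n : ℕ}
    (hO : f =O[𝓝 0] fun z : ℂ => z ^ n) :
    ∃ g : ℂ → ℂ, AnalyticAt ℂ g 0 ∧ ∀ᶠ z in 𝓝 0, f z = z ^ n * g z := by
  have hle : (n : ℕ∞) ≤ analyticOrderAt f 0 := by
    by_contra hlt
    rw [not_le] at hlt
    obtain ⟨m, hm⟩ := ENat.ne_top_iff_exists.1 hlt.ne_top
    rw [← hm] at hlt
    have hmn : m < n := by exact_mod_cast hlt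
    obtain ⟨g, hg, hg0, hfg⟩ := (AnalyticAt.analyticOrderAt_eq_natCast hf).1 hm.symm
    obtain ⟨C, hC⟩ := hO.bound
    have h1 : ∀ᶠ z in 𝓝[≠] (0 : ℂ), ‖g z‖ ≤ C * ‖z‖ ^ (n - m) := by
      filter_upwards [hC.filter_mono nhdsWithin_le_nhds, hfg.filter_mono nhdsWithin_le_nhds,
        self_mem_nhdsWithin] with z h1 h2 h3
      have hz : 0 < ‖z‖ ^ m := pow_pos (norm_pos_iff.2 h3) m
      rw [h2, sub_zero, smul_eq_mul, norm_mul, norm_pow, norm_pow,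
        show n = m + (n - m) by omega, pow_add, mul_left_comm] at h1
      exact le_of_mul_le_mul_left h1 hz
    have h2 : Tendsto (fun z : ℂ => C * ‖z‖ ^ (n - m)) (𝓝[≠] 0) (𝓝 0) := by
      have : Continuous fun z : ℂ => C * ‖z‖ ^ (n - m) := by fun_prop
      have h := (this.tendsto 0).mono_left (nhdsWithin_le_nhds (s := {0}ᶜ))
      simpa [show n - m ≠ 0 by omega] using h
    have h3 : Tendsto (fun z => ‖g z‖) (𝓝[≠] 0) (𝓝 ‖g 0‖) :=
      hg.continuousAt.norm.tendsto.mono_left nhdsWithin_le_nhds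
    have h4 := le_of_tendsto_of_tendsto h3 h2 h1
    exact hg0 (norm_le_zero_iff.1 h4)
  obtain ⟨g, hg, h⟩ := (natCast_le_analyticOrderAt hf).1 hle
  exact ⟨g, hg, by simpa using h⟩

theorem iteratedDeriv_pow_mul_zero {ρ : ℂ → ℂ} (hρ : AnalyticAt ℂ ρ 0) (k ν : ℕ) :
    iteratedDeriv (k + ν) (fun z => z ^ k * ρ z) 0 =
      ((k + ν).factorial : ℂ) / (ν.factorial : ℂ) * iteratedDeriv ν ρ 0 := by
  rw [iteratedDeriv_fun_mul (by fun_prop) hρ.contDiffAt,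
    Finset.sum_eq_single_of_mem k (by simp)]
  · have hc : ((k + ν).choose k : ℂ) * (k.factorial : ℂ) * (ν.factorial : ℂ)
        = (k + ν).factorial := by
      have := Nat.choose_mul_factorial_mul_factorial (Nat.le_add_right k ν)
      rw [Nat.add_sub_cancel_left] at this
      exact_mod_cast this
    have hν : (ν.factorial : ℂ) ≠ 0 := by exact_mod_cast ν.factorial_ne_zero
    rw [iteratedDeriv_fun_pow_zero, if_pos rfl, ← hc, Nat.add_sub_cancel_left]
    field_simp
  · intro i _ hi
    rw [iteratedDeriv_fun_pow_zero, if_neg hi]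
    simp

/-- The exact form of a parabolic expansion of an analytic function. -/
theorem exists_analytic_exponent {f : ℂ → ℂ} (hf : AnalyticAt ℂ f 0) (hf0 : f 0 = 1) {b β : ℂ}
    {μ : ℕ} (hμ : 1 ≤ μ) {r : ℂ → ℂ} (hr : r =O[𝓝 0] fun ξ : ℂ => ξ ^ (2 * μ + 1))
    (hfr : ∀ᶠ ξ in 𝓝 0, f ξ = Complex.exp (b * ξ - β * ξ ^ (2 * μ) + r ξ)) :
    ∃ ρ : ℂ → ℂ, AnalyticAt ℂ ρ 0 ∧ ρ 0 = 0 ∧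
      (∀ ν, iteratedDeriv (ν + 1) ρ 0 / ((ν + 1).factorial : ℂ) =
        iteratedDeriv (2 * μ + (ν + 1)) (fun ξ => Complex.log (f ξ)) 0 /
          ((2 * μ + (ν + 1)).factorial : ℂ)) ∧
      ∀ᶠ ξ in 𝓝 0, f ξ = Complex.exp (b * ξ - β * ξ ^ (2 * μ) + ξ ^ (2 * μ) * ρ ξ) := by
  set G : ℂ → ℂ := fun ξ => Complex.log (f ξ) with hG
  have hGa : AnalyticAt ℂ G 0 := hf.clog (by rw [hf0]; exact Complex.one_mem_slitPlane)
  set q : ℂ → ℂ := fun ξ => G ξ - (b * ξ - β * ξ ^ (2 * μ)) with hq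
  have hpa : AnalyticAt ℂ (fun ξ : ℂ => b * ξ - β * ξ ^ (2 * μ)) 0 := by fun_prop
  have hqa : AnalyticAt ℂ q 0 := hGa.sub hpa
  have hr0 : Tendsto r (𝓝 0) (𝓝 0) := by
    refine hr.trans_tendsto ?_
    have : Continuous fun ξ : ℂ => ξ ^ (2 * μ + 1) := by fun_prop
    simpa using this.tendsto 0
  have hh : Tendsto (fun ξ => b * ξ - β * ξ ^ (2 * μ) + r ξ) (𝓝 0) (𝓝 0) := by
    have h1 := (hpa.continuousAt.tendsto).add hr0
    simpa [show 2 * μ ≠ 0 by omega] using h1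
  have hqr : q =ᶠ[𝓝 0] r := by
    have hsmall : ∀ᶠ ξ in 𝓝 (0 : ℂ), ‖b * ξ - β * ξ ^ (2 * μ) + r ξ‖ < 1 := by
      have := hh.norm
      rw [norm_zero] at this
      exact this.eventually_lt_const one_pos
    filter_upwards [hfr, hsmall] with ξ h1 h2
    have him := (Complex.abs_im_le_norm (b * ξ - β * ξ ^ (2 * μ) + r ξ)).trans_lt h2
    have hpi := Real.pi_gt_three
    rw [abs_lt] at him
    simp only [hq, hG]
    rw [h1, Complex.log_exp (by linarith) (by linarith)]
    ring
  obtain ⟨g, hg, hqg⟩ := exists_eventuallyEq_pow_mul_of_isBigO hqa (hqr.trans_isBigO hr)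
  have hρa : AnalyticAt ℂ (fun ξ => ξ * g ξ) 0 := analyticAt_id.mul hg
  have hqρ : q =ᶠ[𝓝 0] fun ξ => ξ ^ (2 * μ) * (ξ * g ξ) := by
    filter_upwards [hqg] with ξ h
    rw [h]; ring
  refine ⟨fun ξ => ξ * g ξ, hρa, by simp, fun ν => ?_, ?_⟩
  · have h1 : iteratedDeriv (2 * μ + (ν + 1)) q 0 = iteratedDeriv (2 * μ + (ν + 1)) G 0 := by
      have hd : ∀ c : ℂ, ∀ k : ℕ, k < 2 * μ + (ν + 1) →
          iteratedDeriv (2 * μ + (ν + 1)) (fun ξ : ℂ => c * ξ ^ k) 0 = 0 := fun c k hk => by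
        rw [iteratedDeriv_const_mul_field, iteratedDeriv_fun_pow_zero, if_neg (by omega)]; simp
      have hd1 := hd b 1 (by omega)
      simp only [pow_one] at hd1
      rw [hq, iteratedDeriv_fun_sub hGa.contDiffAt hpa.contDiffAt,
        iteratedDeriv_fun_sub (by fun_prop) (by fun_prop), hd1, hd β _ (by omega)]
      simp
    rw [← h1, hqρ.iteratedDeriv_eq, iteratedDeriv_pow_mul_zero hρa]
    have : ((2 * μ + (ν + 1)).factorial : ℂ) ≠ 0 := by exact_mod_cast Nat.factorial_ne_zero _
    field_simp
  · have hne : ∀ᶠ ξ in 𝓝 (0 : ℂ), f ξ ≠ 0 :=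
      hf.continuousAt.eventually_ne (by rw [hf0]; exact one_ne_zero)
    filter_upwards [hqρ, hne] with ξ h1 h2
    rw [← h1]
    simp only [hq, hG, add_sub_cancel]
    rw [Complex.exp_log h2]

end Expansion

end LocalLimit

end

noncomputable section

namespace LocalLimit

open MeasureTheory

/-- The asymptotic expansion of the contribution of one tangency point. -/
theorem exists_norm_local_sub_le {a : ℤ → ℂ} {κ β : ℂ} {α : ℝ} {μ : ℕ} (hκ : ‖κ‖ = 1)
    (hF : ‖symbol a κ‖ = 1) (hμ : 1 ≤ μ) (hβ : 0 < β.re)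
    (han : AnalyticAt ℂ (fun ξ : ℂ => symbol a (κ * Complex.exp (Complex.I * ξ))) 0)
    (hexp : ∃ r : ℂ → ℂ, (r =O[𝓝 0] fun ξ : ℂ => ξ ^ (2 * μ + 1)) ∧ ∀ᶠ ξ : ℂ in 𝓝 0,
      symbol a (κ * Complex.exp (Complex.I * ξ)) = symbol a κ *
        Complex.exp (Complex.I * (α : ℂ) * ξ - β * ξ ^ (2 * μ) + r ξ)) (M : ℕ) :
    ∃ r₀ > 0, ∀ χ : ℝ → ℂ, ContDiff ℝ 2 χ → (∃ δ > 0, ∀ θ, |θ| ≤ δ → χ θ = 1) →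
      (∀ θ, r₀ ≤ |θ| → χ θ = 0) → ∃ C, 0 ≤ C ∧ ∀ n : ℕ, 1 ≤ n → ∀ l : ℤ,
        ‖1 / (2 * (Real.pi : ℂ)) * (κ ^ (-l) * ∫ θ : ℝ, χ θ *
            symbol a (κ * Complex.exp (Complex.I * θ)) ^ n * Complex.exp (-Complex.I * l * θ)) -
          ∑ m ∈ Finset.range (M + 1), scaledProfile a κ α μ m n
            (applyNegDeriv (expansionPoly (cumulant a κ) μ m) (attractor μ β)) l‖ ≤
        C * ((n : ℝ) ^ (1 / (2 * (μ : ℝ))))⁻¹ ^ (M + 2) *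
          (1 + (((l : ℝ) - α * n) / (n : ℝ) ^ (1 / (2 * (μ : ℝ)))) ^ 2)⁻¹ := by
  have hF0 : symbol a κ ≠ 0 := fun h => by simp [h] at hF
  obtain ⟨r, hr, hfr⟩ := hexp
  set f : ℂ → ℂ := fun ξ => symbol a (κ * Complex.exp (Complex.I * ξ)) / symbol a κ with hf
  have hfa : AnalyticAt ℂ f 0 := han.div analyticAt_const hF0
  obtain ⟨ρ, hρ, hρ0, hρν, hρe⟩ := exists_analytic_exponent hfa (by simp [hf, hF0]) hμ hr
    (b := Complex.I * α) (β := β) (by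
      filter_upwards [hfr] with ξ h
      simp only [hf]
      rw [h, mul_div_cancel_left₀ _ hF0])
  have hP := eval_expansionPoly (γ := cumulant a κ) (μ := μ) hρ hρ0 fun ν => by
    rw [hρν, cumulant]
    have : Complex.I ^ (2 * μ + (ν + 1)) ≠ 0 := pow_ne_zero _ Complex.I_ne_zero
    field_simp
    rfl
  obtain ⟨r₁, hr₁, hcore⟩ := exists_remainder_bound hμ hβ hρ hρ0 hP M
  obtain ⟨r₂, hr₂, hρe'⟩ := Metric.eventually_nhds_iff_ball.1 hρe
  refine ⟨min r₁ r₂, lt_min hr₁ hr₂, fun χ hχ hin hout => ?_⟩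
  obtain ⟨C, hC, hbound⟩ := hcore χ hχ hin fun θ hθ => hout θ ((min_le_left _ _).trans hθ)
  refine ⟨C, hC, fun n hn l => ?_⟩
  set N := (n : ℝ) ^ (1 / (2 * (μ : ℝ))) with hN
  have hN1 : 1 ≤ N := one_le_rpow_scale hn μ
  have hN0 : 0 < N := by linarith
  set z := N⁻¹ with hz
  have hz0 : 0 < z := inv_pos.2 hN0
  have hz1 : z ≤ 1 := inv_le_one_of_one_le₀ hN1
  set X := ((l : ℝ) - α * n) / N with hX
  have hnz : (n : ℂ) * (z : ℂ) ^ (2 * μ) = 1 := by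
    have h1 : N ^ (2 * μ) = n := by
      rw [hN, ← Real.rpow_natCast, ← Real.rpow_mul (Nat.cast_nonneg n)]
      have hμ0 : (μ : ℝ) ≠ 0 := by exact_mod_cast (by omega : μ ≠ 0)
      push_cast
      rw [one_div, inv_mul_cancel₀ (by positivity), Real.rpow_one]
    have h2 : (n : ℝ) * z ^ (2 * μ) = 1 := by
      rw [hz, inv_pow, h1, mul_inv_cancel₀]
      exact_mod_cast (by omega : n ≠ 0)
    exact_mod_cast h2
  set G : ℝ → ℂ := fun x => χ (z * x) *
    Complex.exp (-β * (x : ℂ) ^ (2 * μ) + (x : ℂ) ^ (2 * μ) * ρ (z * x)) with hG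
  set e : ℕ → ℝ → ℂ := fun m x => (expansionPoly (cumulant a κ) μ m).eval (Complex.I * x) *
    Complex.exp (-β * (x : ℂ) ^ (2 * μ)) with he
  have hb := hbound z hz0 hz1
  have hei : ∀ m, Integrable fun x => (z : ℂ) ^ m * e m x :=
    fun m => (integrable_eval_mul_exp hμ hβ _).const_mul _
  have hei' : Integrable fun x => ∑ m ∈ Finset.range (M + 1), (z : ℂ) ^ m * e m x :=
    integrable_finsetSum _ fun m _ => hei m
  have hGi : Integrable G := by
    have h1 := (integrable_iteratedDeriv_of_C2BoundAt hb (j := 0) (by norm_num)).1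
    simp only [iteratedDeriv_zero] at h1
    refine (h1.add hei').congr (Eventually.of_forall fun x => ?_)
    simp only [hG, he, Pi.add_apply, sub_add_cancel]
  have hint : ∫ θ : ℝ, χ θ * symbol a (κ * Complex.exp (Complex.I * θ)) ^ n *
      Complex.exp (-Complex.I * l * θ) =
      symbol a κ ^ n * z * ∫ x : ℝ, Complex.exp (-Complex.I * X * x) * G x := by
    set g : ℝ → ℂ := fun θ => χ θ * symbol a (κ * Complex.exp (Complex.I * θ)) ^ n *
      Complex.exp (-Complex.I * l * θ) with hg
    have h1 := Measure.integral_comp_mul_left g z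
    have h2 : ∀ x : ℝ, g (z * x) =
        symbol a κ ^ n * (Complex.exp (-Complex.I * X * x) * G x) := by
      intro x
      simp only [hg, hG]
      rcases le_or_gt (min r₁ r₂) |z * x| with h | h
      · rw [hout _ h]; simp
      · have h3 : symbol a (κ * Complex.exp (Complex.I * ((z * x : ℝ) : ℂ))) =
            symbol a κ * Complex.exp (Complex.I * α * ((z * x : ℝ) : ℂ) -
              β * ((z * x : ℝ) : ℂ) ^ (2 * μ) +
                ((z * x : ℝ) : ℂ) ^ (2 * μ) * ρ ((z * x : ℝ) : ℂ)) := by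
          have := hρe' ((z * x : ℝ) : ℂ) (by
            rw [mem_ball_zero_iff, Complex.norm_real, Real.norm_eq_abs]
            exact h.trans_le (min_le_right _ _))
          rw [← this]
          simp only [hf]
          field_simp
        rw [h3, mul_pow, ← Complex.exp_nat_mul]
        have h4 : (n : ℂ) * (Complex.I * α * ((z * x : ℝ) : ℂ) -
              β * ((z * x : ℝ) : ℂ) ^ (2 * μ) +
                ((z * x : ℝ) : ℂ) ^ (2 * μ) * ρ ((z * x : ℝ) : ℂ)) +
            -Complex.I * l * ((z * x : ℝ) : ℂ) = -Complex.I * X * x +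
              (-β * (x : ℂ) ^ (2 * μ) + (x : ℂ) ^ (2 * μ) * ρ (z * x)) := by
          have hXz : (X : ℂ) = (l - α * n) * z := by
            rw [hX, hz, div_eq_mul_inv]; push_cast; ring
          rw [hXz, Complex.ofReal_mul, mul_pow]
          linear_combination (-β * (x : ℂ) ^ (2 * μ) +
            (x : ℂ) ^ (2 * μ) * ρ (z * x)) * hnz
        calc _ = χ (z * x) * symbol a κ ^ n * (Complex.exp ((n : ℂ) *
              (Complex.I * α * ((z * x : ℝ) : ℂ) - β * ((z * x : ℝ) : ℂ) ^ (2 * μ) +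
                ((z * x : ℝ) : ℂ) ^ (2 * μ) * ρ ((z * x : ℝ) : ℂ))) *
                  Complex.exp (-Complex.I * l * ((z * x : ℝ) : ℂ))) := by ring
          _ = _ := by rw [← Complex.exp_add, h4, Complex.exp_add]; ring
    have h5 : ∫ x : ℝ, g (z * x) =
        symbol a κ ^ n * ∫ x : ℝ, Complex.exp (-Complex.I * X * x) * G x := by
      rw [← integral_const_mul]
      exact integral_congr_ae (Eventually.of_forall h2)
    rw [h5, abs_of_pos (inv_pos.2 hz0), Complex.real_smul, Complex.ofReal_inv] at h1
    have hzc : (z : ℂ) ≠ 0 := by exact_mod_cast hz0.ne'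
    rw [mul_right_comm, h1]
    field_simp
  have hsum : ∑ m ∈ Finset.range (M + 1), scaledProfile a κ α μ m n
        (applyNegDeriv (expansionPoly (cumulant a κ) μ m) (attractor μ β)) l =
      1 / (2 * (Real.pi : ℂ)) * (κ ^ (-l) * (symbol a κ ^ n * z *
        ∫ x : ℝ, Complex.exp (-Complex.I * X * x) *
          ∑ m ∈ Finset.range (M + 1), (z : ℂ) ^ m * e m x)) := by
    simp only [Finset.mul_sum]
    rw [integral_finsetSum _ fun m _ => integrable_exp_mul (hei m) X]
    simp only [Finset.mul_sum]
    refine Finset.sum_congr rfl fun m _ => ?_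
    rw [scaledProfile_eq a κ α hμ hβ]
    have : ∫ x : ℝ, Complex.exp (-Complex.I * X * x) * ((z : ℂ) ^ m * e m x) =
        (z : ℂ) ^ m * ∫ x : ℝ, Complex.exp (-Complex.I * X * x) * e m x := by
      rw [← integral_const_mul]; congr 1; ext x; ring
    rw [this]
    ring
  have hdiff : ∫ x : ℝ, Complex.exp (-Complex.I * X * x) * (G x -
      ∑ m ∈ Finset.range (M + 1), (z : ℂ) ^ m * e m x) =
      (∫ x : ℝ, Complex.exp (-Complex.I * X * x) * G x) -
        ∫ x : ℝ, Complex.exp (-Complex.I * X * x) *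
          ∑ m ∈ Finset.range (M + 1), (z : ℂ) ^ m * e m x := by
    rw [← integral_sub (integrable_exp_mul hGi X) (integrable_exp_mul hei' X)]
    congr 1; ext x; ring
  rw [hint, hsum, ← mul_sub, ← mul_sub, ← mul_sub, ← hdiff]
  have hfin := norm_integral_exp_mul_le hb X
  simp only [norm_mul, norm_zpow, norm_pow, hκ, hF, one_zpow, one_pow, one_mul, norm_div, norm_one,
    Complex.norm_real, Complex.norm_ofNat, Real.norm_of_nonneg Real.pi_pos.le,
    Real.norm_of_nonneg hz0.le]
  calc _ ≤ 1 / (2 * Real.pi) * (z * (2 * Real.pi * (C * z ^ (M + 1)) * (1 + X ^ 2)⁻¹)) := by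
        gcongr
    _ = C * z ^ (M + 2) * (1 + X ^ 2)⁻¹ := by
        have := Real.pi_pos
        rw [pow_succ z (M + 1)]
        field_simp

end LocalLimit

end

noncomputable section

namespace LocalLimit

open MeasureTheory

/-- A smooth cutoff on the circle around the point `κ`, as a function of the angle. -/
def circleCutoff (b : ContDiffBump (1 : ℂ)) (κ : ℂ) (φ : ℝ) : ℂ :=
  ((b (Complex.exp (Complex.I * φ) / κ) : ℝ) : ℂ)

/-- The cutoff around the point `1` of the circle, as a compactly supported function on the line. -/
def lineCutoff (b : ContDiffBump (1 : ℂ)) (θ : ℝ) : ℂ :=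
  circleCutoff b 1 θ * (((⟨1, 2, one_pos, one_lt_two⟩ : ContDiffBump (0 : ℝ)) θ : ℝ) : ℂ)

variable {b : ContDiffBump (1 : ℂ)}

theorem contDiff_circleCutoff (κ : ℂ) : ContDiff ℝ 2 (circleCutoff b κ) := by
  refine Complex.ofRealCLM.contDiff.comp (b.contDiff.comp ?_)
  have h : ContDiff ℝ 2 fun φ : ℝ => Complex.exp (Complex.I * (Complex.ofRealCLM φ)) :=
    (contDiff_const.mul Complex.ofRealCLM.contDiff).cexp
  exact h.div_const κ

theorem exp_I_mul_add_two_pi (φ : ℝ) :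
    Complex.exp (Complex.I * ((φ + 2 * Real.pi : ℝ) : ℂ)) = Complex.exp (Complex.I * φ) := by
  rw [Complex.exp_eq_exp_iff_exists_int]
  exact ⟨1, by push_cast; ring⟩

theorem periodic_circleCutoff (κ : ℂ) : Function.Periodic (circleCutoff b κ) (2 * Real.pi) :=
  fun φ => by rw [circleCutoff, exp_I_mul_add_two_pi, circleCutoff]

theorem contDiff_lineCutoff : ContDiff ℝ 2 (lineCutoff b) :=
  (contDiff_circleCutoff 1).mul
    (Complex.ofRealCLM.contDiff.comp (ContDiffBump.contDiff _))

theorem circleCutoff_one_eq_zero {r θ : ℝ} (hb : b.rOut ≤ 2 / Real.pi * r) (hr : r ≤ |θ|)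
    (hθ : |θ| ≤ Real.pi) : circleCutoff b 1 θ = 0 := by
  have hpi := Real.pi_pos
  have h1 := Real.mul_le_sin (x := |θ| / 2) (by positivity) (by linarith)
  have h2 : ‖Complex.exp (Complex.I * θ) - 1‖ = 2 * Real.sin (|θ| / 2) := by
    have h0 : 0 ≤ Real.sin (|θ| / 2) :=
      Real.sin_nonneg_of_nonneg_of_le_pi (by positivity) (by linarith)
    rw [Complex.norm_exp_I_mul_ofReal_sub_one, Real.norm_eq_abs, abs_mul, abs_two,
      ← abs_of_nonneg h0]
    congr 1
    rcases abs_cases θ with ⟨h, _⟩ | ⟨h, _⟩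
    · rw [h]
    · rw [h, neg_div, Real.sin_neg, abs_neg]
  have h3 : b.rOut ≤ dist (Complex.exp (Complex.I * θ) / 1) 1 := by
    rw [div_one, dist_eq_norm, h2]
    have h4 : 2 / Real.pi * r ≤ 2 / Real.pi * |θ| := by gcongr
    linarith
  rw [circleCutoff, b.zero_of_le_dist h3, Complex.ofReal_zero]

theorem lineCutoff_eq_zero {r θ : ℝ} (hb : b.rOut ≤ 2 / Real.pi * r) (hr : r ≤ |θ|) :
    lineCutoff b θ = 0 := by
  rcases le_or_gt |θ| Real.pi with h | h
  · rw [lineCutoff, circleCutoff_one_eq_zero hb hr h, zero_mul]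
  · rw [lineCutoff, ContDiffBump.zero_of_le_dist, Complex.ofReal_zero, mul_zero]
    rw [dist_zero_right, Real.norm_eq_abs]
    change (2 : ℝ) ≤ |θ|
    linarith [Real.pi_gt_three]

theorem lineCutoff_eq_circleCutoff {θ : ℝ} (hb : b.rOut ≤ 2 / Real.pi) (hθ : |θ| ≤ Real.pi) :
    lineCutoff b θ = circleCutoff b 1 θ := by
  rcases le_or_gt |θ| 1 with h | h
  · rw [lineCutoff, ContDiffBump.one_of_mem_closedBall, Complex.ofReal_one, mul_one]
    simpa using h
  · rw [lineCutoff, circleCutoff_one_eq_zero (r := 1) (by simpa using hb) h.le hθ, zero_mul]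

theorem lineCutoff_eq_one {θ : ℝ} (hb : b.rOut ≤ 2 / Real.pi) (hθ : |θ| ≤ min b.rIn 1) :
    lineCutoff b θ = 1 := by
  have h1 := hθ.trans (min_le_right _ _)
  rw [lineCutoff_eq_circleCutoff hb (by linarith [Real.pi_gt_three]), circleCutoff,
    b.one_of_mem_closedBall, Complex.ofReal_one]
  rw [div_one, mem_closedBall_iff_norm]
  exact (Real.norm_exp_I_mul_ofReal_sub_one_le).trans (hθ.trans (min_le_left _ _))

/-- The contribution of a neighbourhood of `κ` to a Fourier coefficient, as an integral on the
real line. -/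
theorem zpow_mul_integral_lineCutoff (hb : b.rOut ≤ 2 / Real.pi) {κ : ℂ} (hκ : ‖κ‖ = 1)
    (F : ℂ → ℂ) (l : ℤ) :
    κ ^ (-l) * ∫ θ : ℝ, lineCutoff b θ * F (κ * Complex.exp (Complex.I * θ)) *
        Complex.exp (-Complex.I * l * θ) =
      ∫ φ in (-Real.pi)..Real.pi, circleCutoff b κ φ * F (Complex.exp (Complex.I * φ)) *
        Complex.exp (-Complex.I * l * φ) := by
  have hpi := Real.pi_gt_three
  obtain ⟨θ₀, hθ₀⟩ : ∃ θ₀ : ℝ, κ = Complex.exp (Complex.I * θ₀) := by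
    obtain ⟨t, ht⟩ := (Complex.norm_eq_one_iff κ).1 hκ
    exact ⟨t, by rw [← ht, mul_comm]⟩
  set h : ℝ → ℂ := fun φ => circleCutoff b κ φ * F (Complex.exp (Complex.I * φ)) *
        Complex.exp (-Complex.I * l * φ) with hh
  have hper : Function.Periodic h (2 * Real.pi) := fun φ => by
    simp only [hh]
    rw [periodic_circleCutoff, exp_I_mul_add_two_pi]
    congr 1
    rw [Complex.exp_eq_exp_iff_exists_int]
    exact ⟨-l, by push_cast; ring⟩
  have hsupp : Function.support (fun θ : ℝ => lineCutoff b θ *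
      F (κ * Complex.exp (Complex.I * θ)) * Complex.exp (-Complex.I * l * θ)) ⊆
      Set.Ioc (-Real.pi) Real.pi := by
    intro θ hθ
    have h1 : |θ| < 1 := by
      by_contra hcon
      refine hθ ?_
      simp only
      rw [lineCutoff_eq_zero (r := 1) (by simpa using hb) (not_lt.1 hcon), zero_mul, zero_mul]
    rw [abs_lt] at h1
    exact ⟨by linarith, by linarith⟩
  rw [← intervalIntegral.integral_eq_integral_of_support_subset hsupp,
    ← intervalIntegral.integral_const_mul]
  have h2 : ∫ φ in (-Real.pi)..Real.pi, h φ = ∫ θ in (-Real.pi)..Real.pi, h (θ + θ₀) := by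
    rw [intervalIntegral.integral_comp_add_right]
    have := hper.intervalIntegral_add_eq (-Real.pi) (-Real.pi + θ₀)
    rw [show -Real.pi + 2 * Real.pi = Real.pi by ring,
      show -Real.pi + θ₀ + 2 * Real.pi = Real.pi + θ₀ by ring] at this
    exact this
  rw [h2]
  refine intervalIntegral.integral_congr fun θ hθ => ?_
  rw [Set.uIcc_of_le (by linarith)] at hθ
  have hκ0 : κ ≠ 0 := by rintro rfl; simp at hκ
  have e1 : Complex.exp (Complex.I * ((θ + θ₀ : ℝ) : ℂ)) = κ * Complex.exp (Complex.I * θ) := by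
    rw [hθ₀, ← Complex.exp_add]; congr 1; push_cast; ring
  have e2 : Complex.exp (-Complex.I * l * ((θ + θ₀ : ℝ) : ℂ)) =
      κ ^ (-l) * Complex.exp (-Complex.I * l * θ) := by
    rw [hθ₀, ← Complex.exp_int_mul, ← Complex.exp_add]; congr 1; push_cast; ring
  have e3 : circleCutoff b κ (θ + θ₀) = circleCutoff b 1 θ := by
    rw [circleCutoff, e1, mul_div_cancel_left₀ _ hκ0, circleCutoff, div_one]
  simp only [hh]
  rw [lineCutoff_eq_circleCutoff hb (abs_le.2 hθ), e1, e2, e3]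
  ring

theorem exists_C2BoundAt_of_periodic {f : ℝ → ℂ} (hf : ContDiff ℝ 2 f) {T : ℝ} (hT : T ≠ 0)
    (hper : Function.Periodic f T) : ∃ C, ∀ t, C2BoundAt f C t := by
  have h : ∀ j ≤ 2, ∃ C, ∀ θ, ‖iteratedDeriv j f θ‖ ≤ C := fun j hj => by
    have hc : Continuous (iteratedDeriv j f) := hf.continuous_iteratedDeriv j (by exact_mod_cast hj)
    have hp : Function.Periodic (iteratedDeriv j f) T := fun θ => by
      have := congrFun (iteratedDeriv_comp_add_const (n := j) (f := f) (s := T)) θ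
      rw [← this, show (fun z => f (z + T)) = f from funext hper]
    obtain ⟨C, hC⟩ := (hp.isBounded_of_continuous hT hc).exists_norm_le
    exact ⟨C, fun θ => hC _ ⟨θ, rfl⟩⟩
  obtain ⟨C, -, hC⟩ := exists_forall_le_two_le h
  exact ⟨C, fun t => ⟨hf.contDiffAt, fun j hj => hC j hj t⟩⟩

/-- The part of the circle away from the tangency points contributes an exponentially small
term. -/
theorem exists_norm_gap_le {F : ℂ → ℂ} {U : Set ℂ} (hU : IsOpen U)
    (hsph : Metric.sphere (0 : ℂ) 1 ⊆ U) (hF : DifferentiableOn ℂ F U) {K : ℕ} {κ : Fin K → ℂ}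
    (hκ : ∀ k, ‖κ k‖ = 1) (hlt : ∀ z : ℂ, ‖z‖ = 1 → z ∉ Set.range κ → ‖F z‖ < 1)
    (hsep : ∀ j k, j ≠ k → 2 * b.rOut ≤ ‖κ j - κ k‖) :
    ∃ C q : ℝ, 0 ≤ C ∧ 0 < q ∧ q < 1 ∧ ∀ (n : ℕ) (l : ℤ),
      ‖∫ φ in (-Real.pi)..Real.pi, (1 - ∑ k, circleCutoff b (κ k) φ) *
        F (Complex.exp (Complex.I * φ)) ^ n * Complex.exp (-Complex.I * l * φ)‖ ≤
        C * q ^ n * (1 + (l : ℝ) ^ 2)⁻¹ := by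
  have hdist : ∀ k (z : ℂ), dist (z / κ k) 1 = ‖z - κ k‖ := fun k z => by
    have hk : κ k ≠ 0 := by intro h; have := hκ k; simp [h] at this
    have : z / κ k - 1 = (z - κ k) / κ k := by field_simp
    rw [dist_eq_norm, this, norm_div, hκ, div_one]
  set Y : ℝ → ℂ := fun φ => 1 - ∑ k, circleCutoff b (κ k) φ with hY
  have hYc : ContDiff ℝ 2 Y :=
    contDiff_const.sub (ContDiff.sum fun k _ => contDiff_circleCutoff (κ k))
  have hYp : Function.Periodic Y (2 * Real.pi) := fun φ => by
    simp only [hY]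
    congr 1
    exact Finset.sum_congr rfl fun k _ => periodic_circleCutoff (κ k) φ
  obtain ⟨B, hB⟩ := exists_C2BoundAt_of_periodic hYc (by positivity) hYp
  have hY0 : ∀ φ : ℝ, ∀ k, ‖Complex.exp (Complex.I * φ) - κ k‖ < b.rIn → Y φ = 0 := by
    intro φ k hk
    have h1 : circleCutoff b (κ k) φ = 1 := by
      rw [circleCutoff, b.one_of_mem_closedBall, Complex.ofReal_one]
      rw [Metric.mem_closedBall, hdist]; exact hk.le
    have h2 : ∀ j, j ≠ k → circleCutoff b (κ j) φ = 0 := fun j hj => by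
      rw [circleCutoff, b.zero_of_le_dist, Complex.ofReal_zero]
      rw [hdist]
      have h3 := hsep j k hj
      have h4 : ‖κ j - κ k‖ ≤ ‖Complex.exp (Complex.I * φ) - κ j‖ +
          ‖Complex.exp (Complex.I * φ) - κ k‖ := by
        have := norm_sub_le (Complex.exp (Complex.I * φ) - κ k) (Complex.exp (Complex.I * φ) - κ j)
        rw [sub_sub_sub_cancel_left] at this
        linarith
      linarith [b.rIn_lt_rOut]
    simp only [hY]
    rw [Finset.sum_eq_single k (fun j _ hj => h2 j hj) (by simp), h1, sub_self]
  set S : Set ℂ := {z | ‖z‖ = 1 ∧ ∀ k, b.rIn ≤ ‖z - κ k‖} with hS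
  have hSc : IsCompact S := by
    refine (isCompact_sphere (0 : ℂ) 1).of_isClosed_subset ?_ fun z hz => by simpa using hz.1
    have h : S = {z | ‖z‖ = 1} ∩ ⋂ k, {z : ℂ | b.rIn ≤ ‖z - κ k‖} := by ext z; simp [hS]
    rw [h]
    exact (isClosed_eq continuous_norm continuous_const).inter
      (isClosed_iInter fun k => isClosed_le continuous_const (by fun_prop))
  have hSU : S ⊆ U := fun z hz => hsph (by simpa using hz.1)
  obtain ⟨q, hq0, hq1, hq⟩ : ∃ q : ℝ, 0 < q ∧ q < 1 ∧ ∀ z ∈ S, ‖F z‖ < q := by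
    rcases S.eq_empty_or_nonempty with hE | hne
    · exact ⟨1 / 2, by norm_num, by norm_num, by simp [hE]⟩
    · obtain ⟨z₀, hz₀, hmax⟩ := hSc.exists_isMaxOn hne (hF.continuousOn.mono hSU).norm
      have h1 : ‖F z₀‖ < 1 := hlt z₀ hz₀.1 (by
        rintro ⟨k, rfl⟩
        have := hz₀.2 k
        rw [sub_self, norm_zero] at this
        linarith [b.rIn_pos])
      have h0 := norm_nonneg (F z₀)
      refine ⟨(‖F z₀‖ + 1) / 2, by positivity, by linarith, fun z hz => ?_⟩
      have : ‖F z‖ ≤ ‖F z₀‖ := hmax hz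
      linarith
  set V : Set ℂ := U ∩ F ⁻¹' Metric.ball 0 q with hV
  have hVo : IsOpen V := hF.continuousOn.isOpen_inter_preimage hU Metric.isOpen_ball
  obtain ⟨η, hη, hηV⟩ := hSc.exists_cthickening_subset_open hVo fun z hz =>
    ⟨hSU hz, by simpa using hq z hz⟩
  set η' := min 1 (η / 2) with hη'
  have hη'0 : 0 < η' := by positivity
  have hη'1 : η' ≤ 1 := min_le_left _ _
  have hη'2 : η' ≤ η / 2 := min_le_right _ _
  have hB0 : 0 ≤ B := (hB 0).nonneg
  refine ⟨4 * Real.pi * (4 * (B * (2 / η' ^ 2))), q, by positivity, hq0, hq1, fun n l => ?_⟩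
  refine (norm_intervalIntegral_exp_mul_le (B := 4 * (B * (2 * q ^ n / η' ^ 2))) ?_ ?_ l).trans
    (le_of_eq (by ring))
  · intro φ
    change Y _ * _ = Y _ * _
    rw [hYp, exp_I_mul_add_two_pi]
  · intro φ
    by_cases hφ : Complex.exp (Complex.I * φ) ∈ S
    · refine (hB φ).mul ?_
      have hball : Metric.closedBall (φ : ℂ) η' ⊆ (fun ζ : ℂ => Complex.exp (Complex.I * ζ)) ⁻¹' V := by
        intro ζ hζ
        rw [mem_closedBall_iff_norm] at hζ
        refine hηV (Metric.closedBall_subset_cthickening hφ η ?_)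
        rw [mem_closedBall_iff_norm]
        have e : Complex.exp (Complex.I * ζ) - Complex.exp (Complex.I * φ) =
            Complex.exp (Complex.I * φ) * (Complex.exp (Complex.I * (ζ - φ)) - 1) := by
          rw [mul_sub, ← Complex.exp_add, mul_one]; congr 2; ring
        have hn : ‖Complex.I * (ζ - φ)‖ ≤ 1 := by
          rw [norm_mul, Complex.norm_I, one_mul]; exact hζ.trans hη'1
        have h5 := Complex.norm_exp_sub_one_le hn
        rw [norm_mul Complex.I, Complex.norm_I, one_mul] at h5
        rw [e, norm_mul, hφ.1, one_mul]
        linarith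
      refine C2BoundAt.of_holomorphic (f := fun ζ : ℂ => F (Complex.exp (Complex.I * ζ)) ^ n)
        (hVo.preimage (by fun_prop)) ?_ hη'0 hη'1 hball fun ζ hζ => ?_
      · exact (DifferentiableOn.comp (g := F) hF (by fun_prop) fun ζ hζ => hζ.1).pow n
      · rw [norm_pow]
        refine pow_le_pow_left₀ (norm_nonneg _) ?_ n
        have := (hball hζ).2
        simp only [Set.mem_preimage, mem_ball_zero_iff] at this
        exact this.le
    · refine C2BoundAt.of_eventuallyEq_zero ?_ (by positivity)
      have h6 : ∃ k, ‖Complex.exp (Complex.I * φ) - κ k‖ < b.rIn := by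
        by_contra hcon
        push Not at hcon
        exact hφ ⟨by simp [mul_comm Complex.I], hcon⟩
      obtain ⟨k, hk⟩ := h6
      have hc : Continuous fun x : ℝ => ‖Complex.exp (Complex.I * x) - κ k‖ := by fun_prop
      filter_upwards [(hc.tendsto φ).eventually_lt_const hk] with x hx
      change Y x * _ = 0
      rw [hY0 x k hx, zero_mul]

end LocalLimit

end

noncomputable section

namespace LocalLimit

theorem range_succ_eq_insert_Icc (M : ℕ) : Finset.range (M + 1) = insert 0 (Finset.Icc 1 M) := by
  ext m
  simp only [Finset.mem_range, Finset.mem_insert, Finset.mem_Icc]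
  omega

theorem exists_pow_le_div_rpow {q : ℝ} (hq0 : 0 < q) (hq1 : q < 1) (A : ℕ) :
    ∃ C, 0 ≤ C ∧ ∀ n : ℕ, 1 ≤ n → ∀ s : ℝ, s ≤ A → q ^ n ≤ C / (n : ℝ) ^ s := by
  obtain ⟨C, hC⟩ := (tendsto_pow_const_mul_const_pow_of_lt_one A hq0.le hq1).bddAbove_range
  have hC' : ∀ n : ℕ, (n : ℝ) ^ A * q ^ n ≤ C := fun n => hC ⟨n, rfl⟩
  refine ⟨C, le_trans (by positivity) (hC' 1), fun n hn s hs => ?_⟩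
  have hn1 : (1 : ℝ) ≤ n := by exact_mod_cast hn
  rw [le_div_iff₀ (by positivity)]
  refine le_trans ?_ (hC' n)
  rw [mul_comm, ← Real.rpow_natCast (n : ℝ) A]
  gcongr

theorem inv_rpow_pow_le {n : ℕ} (hn : 1 ≤ n) {μ ν : ℕ} (hμ : 1 ≤ μ) (hμν : μ ≤ ν) (M : ℕ) :
    ((n : ℝ) ^ (1 / (2 * (μ : ℝ))))⁻¹ ^ (M + 1) ≤
      1 / (n : ℝ) ^ (((M : ℝ) + 1) / (2 * (ν : ℝ))) := by
  have hn1 : (1 : ℝ) ≤ n := by exact_mod_cast hn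
  have hμ0 : (0 : ℝ) < μ := by exact_mod_cast hμ
  have hμν' : (μ : ℝ) ≤ ν := by exact_mod_cast hμν
  have hν0 : (0 : ℝ) < ν := hμ0.trans_le hμν'
  rw [inv_pow, ← Real.rpow_natCast, ← Real.rpow_mul (Nat.cast_nonneg n), ← one_div]
  refine one_div_le_one_div_of_le (by positivity) (Real.rpow_le_rpow_of_exponent_le hn1 ?_)
  push_cast
  rw [one_div_mul_eq_div]
  gcongr

variable {a : ℤ → ℂ} {K : ℕ} {κ : Fin K → ℂ} {α : Fin K → ℝ} {β : Fin K → ℂ} {μ : Fin K → ℕ}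

/-- The difference between an iterated convolution and its asymptotic expansion. -/
def remainder (a : ℤ → ℂ) (κ : Fin K → ℂ) (α : Fin K → ℝ) (β : Fin K → ℂ) (μ : Fin K → ℕ)
    (M n : ℕ) (l : ℤ) : ℂ :=
  convPow a n l - ∑ k, ∑ m ∈ Finset.range (M + 1), scaledProfile a (κ k) (α k) (μ k) m n
    (applyNegDeriv (expansionPoly (cumulant a (κ k)) (μ k) m) (attractor (μ k) (β k))) l

theorem HolomorphicNormalized.exists_open (ha : HolomorphicNormalized a) :
    ∃ U : Set ℂ, IsOpen U ∧ Metric.sphere (0 : ℂ) 1 ⊆ U ∧ DifferentiableOn ℂ (symbol a) U := by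
  obtain ⟨ε, hε, -, hd⟩ := ha.holomorphic
  refine ⟨_, ?_, ?_, hd⟩
  · exact (isOpen_lt continuous_const continuous_norm).inter
      (isOpen_lt continuous_norm continuous_const)
  · intro z hz
    have : ‖z‖ = 1 := by simpa using hz
    exact ⟨by linarith, by linarith⟩

theorem HolomorphicNormalized.summable_norm (ha : HolomorphicNormalized a) :
    Summable fun l => ‖a l‖ := by
  simpa using ha.mem_l1.summable (by simp)

theorem exists_norm_remainder_le (ha : HolomorphicNormalized a)
    (hκ : ParabolicTangency a K κ α β μ) (M : ℕ) :
    ∃ (C₀ q : ℝ) (C : Fin K → ℝ), 0 ≤ C₀ ∧ 0 < q ∧ q < 1 ∧ (∀ k, 0 ≤ C k) ∧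
      ∀ n : ℕ, 1 ≤ n → ∀ l : ℤ, ‖remainder a κ α β μ M n l‖ ≤
        C₀ * q ^ n * (1 + (((l : ℝ) - 0) / 1) ^ 2)⁻¹ +
        ∑ k, C k * ((n : ℝ) ^ (1 / (2 * (μ k : ℝ))))⁻¹ ^ (M + 2) *
          (1 + (((l : ℝ) - α k * n) / (n : ℝ) ^ (1 / (2 * (μ k : ℝ)))) ^ 2)⁻¹ := by
  obtain ⟨U, hU, hsph, hd⟩ := ha.exists_open
  have has := ha.summable_norm
  have hlocal := fun k => exists_norm_local_sub_le (hκ.norm_point k) (hκ.norm_symbol k)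
    (hκ.order_pos k) (hκ.re_pos k) (by
      have h1 : AnalyticAt ℂ (symbol a) (κ k * Complex.exp (Complex.I * 0)) := by
        refine hd.analyticAt (hU.mem_nhds (hsph ?_))
        simpa using hκ.norm_point k
      exact h1.comp (f := fun ξ : ℂ => κ k * Complex.exp (Complex.I * ξ)) (by fun_prop))
    (hκ.expansion k) M
  choose r hr hχ using hlocal
  have hpi := Real.pi_pos
  obtain ⟨d, hd0, hd1, hdr, hdsep⟩ : ∃ d : ℝ, 0 < d ∧ d ≤ 2 / Real.pi ∧
      (∀ k, d ≤ 2 / Real.pi * r k) ∧ ∀ j k, j ≠ k → 2 * d ≤ ‖κ j - κ k‖ := by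
    have h1 : ∀ᶠ d in 𝓝[>] (0 : ℝ), d ≤ 2 / Real.pi :=
      (eventually_le_nhds (by positivity)).filter_mono nhdsWithin_le_nhds
    have h2 : ∀ᶠ d in 𝓝[>] (0 : ℝ), ∀ k, d ≤ 2 / Real.pi * r k :=
      eventually_all.2 fun k => (eventually_le_nhds (by have := hr k; positivity)).filter_mono
        nhdsWithin_le_nhds
    have h3 : ∀ᶠ d in 𝓝[>] (0 : ℝ), ∀ j k, j ≠ k → 2 * d ≤ ‖κ j - κ k‖ := by
      refine eventually_all.2 fun j => eventually_all.2 fun k => ?_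
      by_cases hjk : j = k
      · simp [hjk]
      · have : 0 < ‖κ j - κ k‖ / 2 :=
          half_pos (norm_pos_iff.2 (sub_ne_zero.2 fun h => hjk (hκ.injective h)))
        filter_upwards [(eventually_le_nhds this).filter_mono nhdsWithin_le_nhds] with d hd _
        linarith
    obtain ⟨d, ⟨⟨h1, h2⟩, h3⟩, h4⟩ := (((h1.and h2).and h3).and self_mem_nhdsWithin).exists
    exact ⟨d, h4, h1, h2, h3⟩
  let b : ContDiffBump (1 : ℂ) := ⟨d / 2, d, half_pos hd0, half_lt_self hd0⟩
  have hbOut : b.rOut = d := rfl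
  have hb1 : b.rOut ≤ 2 / Real.pi := hd1
  obtain ⟨C₀, q, hC₀, hq0, hq1, hgap⟩ := exists_norm_gap_le (b := b) hU hsph hd hκ.norm_point
    hκ.norm_symbol_lt hdsep
  have hC := fun k => hχ k (lineCutoff b) contDiff_lineCutoff
    ⟨min b.rIn 1, lt_min b.rIn_pos one_pos, fun θ hθ => lineCutoff_eq_one hb1 hθ⟩
    fun θ hθ => lineCutoff_eq_zero (hdr k) hθ
  choose C hC0 hCb using hC
  refine ⟨1 / (2 * Real.pi) * C₀, q, C, by positivity, hq0, hq1, hC0, fun n hn l => ?_⟩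
  set Φ : ℝ → ℂ := fun φ => symbol a (Complex.exp (Complex.I * φ)) with hΦ
  set E : ℝ → ℂ := fun φ => Complex.exp (-Complex.I * l * φ) with hE
  have hΦc : Continuous Φ := by
    refine hd.continuousOn.comp_continuous (by fun_prop) fun φ => hsph ?_
    simp [mul_comm Complex.I]
  have hEc : Continuous E := by fun_prop
  have hcoeff : convPow a n l = 1 / (2 * (Real.pi : ℂ)) *
      ∫ φ in (-Real.pi)..Real.pi, Φ φ ^ n * E φ := by
    rw [coeff_eq_integral (summable_norm_convPow has n) l]
    congr 1
    refine intervalIntegral.integral_congr fun φ _ => ?_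
    simp only [hΦ, hE]
    rw [symbol_convPow has (by simp [mul_comm Complex.I])]
  have hloc : ∀ k, κ k ^ (-l) * ∫ θ : ℝ, lineCutoff b θ *
      symbol a (κ k * Complex.exp (Complex.I * θ)) ^ n * Complex.exp (-Complex.I * l * θ) =
      ∫ φ in (-Real.pi)..Real.pi, circleCutoff b (κ k) φ * Φ φ ^ n * E φ := fun k =>
    zpow_mul_integral_lineCutoff hb1 (hκ.norm_point k) (fun z => symbol a z ^ n) l
  have hci : ∀ k, IntervalIntegrable (fun φ => circleCutoff b (κ k) φ * Φ φ ^ n * E φ)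
      MeasureTheory.volume (-Real.pi) Real.pi := fun k =>
    (((contDiff_circleCutoff (κ k)).continuous.mul (hΦc.pow n)).mul hEc).intervalIntegrable _ _
  have hsplit : ∫ φ in (-Real.pi)..Real.pi, Φ φ ^ n * E φ =
      (∫ φ in (-Real.pi)..Real.pi, (1 - ∑ k, circleCutoff b (κ k) φ) * Φ φ ^ n * E φ) +
        ∑ k, ∫ φ in (-Real.pi)..Real.pi, circleCutoff b (κ k) φ * Φ φ ^ n * E φ := by
    rw [← intervalIntegral.integral_finsetSum fun k _ => hci k, ← intervalIntegral.integral_add]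
    · refine intervalIntegral.integral_congr fun φ _ => ?_
      simp only [sub_mul, Finset.sum_mul, one_mul, sub_add_cancel]
    · refine Continuous.intervalIntegrable ?_ _ _
      refine ((continuous_const.sub (continuous_finsetSum _ fun k _ => ?_)).mul
        (hΦc.pow n)).mul hEc
      exact (contDiff_circleCutoff (κ k)).continuous
    · exact Continuous.intervalIntegrable (continuous_finsetSum _ fun k _ =>
        ((contDiff_circleCutoff (κ k)).continuous.mul (hΦc.pow n)).mul hEc) _ _
  have hrem : remainder a κ α β μ M n l = 1 / (2 * (Real.pi : ℂ)) *
      (∫ φ in (-Real.pi)..Real.pi, (1 - ∑ k, circleCutoff b (κ k) φ) * Φ φ ^ n * E φ) +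
      ∑ k, (1 / (2 * (Real.pi : ℂ)) * (κ k ^ (-l) * ∫ θ : ℝ, lineCutoff b θ *
          symbol a (κ k * Complex.exp (Complex.I * θ)) ^ n * Complex.exp (-Complex.I * l * θ)) -
        ∑ m ∈ Finset.range (M + 1), scaledProfile a (κ k) (α k) (μ k) m n
          (applyNegDeriv (expansionPoly (cumulant a (κ k)) (μ k) m)
            (attractor (μ k) (β k))) l) := by
    rw [remainder, hcoeff, hsplit, Finset.sum_sub_distrib, ← Finset.mul_sum]
    simp only [hloc]
    ring
  rw [hrem]
  refine (norm_add_le _ _).trans (add_le_add ?_ (norm_sum_le_of_le _ fun k _ => hCb k n hn l))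
  have h := hgap n l
  rw [norm_mul, norm_div, norm_one, norm_mul, Complex.norm_ofNat, Complex.norm_real,
    Real.norm_of_nonneg hpi.le, sub_zero, div_one, mul_assoc, mul_assoc]
  gcongr
  rw [← mul_assoc]
  exact h

theorem exists_tsum_norm_remainder_le (ha : HolomorphicNormalized a)
    (hκ : ParabolicTangency a K κ α β μ) (M : ℕ) :
    ∃ C, 0 < C ∧ ∀ n : ℕ, 1 ≤ n → Summable (fun l => ‖remainder a κ α β μ M n l‖) ∧
      ∑' l, ‖remainder a κ α β μ M n l‖ ≤
        C / (n : ℝ) ^ (((M : ℝ) + 1) / (2 * ((Finset.univ.sup μ : ℕ) : ℝ))) := by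
  obtain ⟨C₀, q, C, hC₀, hq0, hq1, hC, hb⟩ := exists_norm_remainder_le ha hκ M
  obtain ⟨Cq, hCq, hqb⟩ := exists_pow_le_div_rpow hq0 hq1 (M + 1)
  refine ⟨1 + (15 * (C₀ * Cq) + ∑ k, 15 * C k), ?_, fun n hn => ?_⟩
  · have : 0 ≤ ∑ k, 15 * C k := Finset.sum_nonneg fun k _ => mul_nonneg (by norm_num) (hC k)
    positivity
  set s := ((M : ℝ) + 1) / (2 * ((Finset.univ.sup μ : ℕ) : ℝ)) with hs
  have hn0 : (0 : ℝ) < n := by exact_mod_cast hn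
  have hD : 0 < (n : ℝ) ^ s := Real.rpow_pos_of_pos hn0 s
  have hsM : s ≤ ((M + 1 : ℕ) : ℝ) := by
    have h1 : 1 ≤ Finset.univ.sup μ :=
      (hκ.order_pos ⟨0, hκ.one_le_card⟩).trans (Finset.le_sup (f := μ) (Finset.mem_univ _))
    have h2 : (1 : ℝ) ≤ ((Finset.univ.sup μ : ℕ) : ℝ) := by exact_mod_cast h1
    rw [hs, div_le_iff₀ (by positivity)]
    push_cast
    nlinarith [Nat.cast_nonneg (α := ℝ) M]
  have h0 := summable_inv_one_add_sq_and_tsum_le (le_refl (1 : ℝ)) 0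
  have h1 := fun k => summable_inv_one_add_sq_and_tsum_le (one_le_rpow_scale hn (μ k)) (α k * n)
  have hsum0 := h0.1.mul_left (C₀ * q ^ n)
  have hsum1 := fun k =>
    (h1 k).1.mul_left (C k * ((n : ℝ) ^ (1 / (2 * (μ k : ℝ))))⁻¹ ^ (M + 2))
  have hsum2 := summable_sum (s := Finset.univ) fun k _ => hsum1 k
  have hsum := hsum0.add hsum2
  have hrs : Summable fun l => ‖remainder a κ α β μ M n l‖ :=
    Summable.of_nonneg_of_le (fun _ => norm_nonneg _) (hb n hn) hsum
  refine ⟨hrs, (hrs.tsum_le_tsum (hb n hn) hsum).trans ?_⟩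
  rw [hsum0.tsum_add hsum2, Summable.tsum_finsetSum fun k _ => hsum1 k, tsum_mul_left]
  simp only [tsum_mul_left]
  have e0 : C₀ * q ^ n * ∑' l : ℤ, (1 + (((l : ℝ) - 0) / 1) ^ 2)⁻¹ ≤
      15 * (C₀ * Cq) / (n : ℝ) ^ s := by
    calc _ ≤ C₀ * (Cq / (n : ℝ) ^ s) * (15 * 1) := by
          gcongr
          · exact hqb n hn s hsM
          · exact h0.2
      _ = _ := by ring
  have e1 : ∀ k, C k * ((n : ℝ) ^ (1 / (2 * (μ k : ℝ))))⁻¹ ^ (M + 2) *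
      ∑' l : ℤ, (1 + (((l : ℝ) - α k * n) / (n : ℝ) ^ (1 / (2 * (μ k : ℝ)))) ^ 2)⁻¹ ≤
      15 * C k * (1 / (n : ℝ) ^ s) := fun k => by
    have hN := one_le_rpow_scale hn (μ k)
    have hk := hC k
    calc _ ≤ C k * ((n : ℝ) ^ (1 / (2 * (μ k : ℝ))))⁻¹ ^ (M + 2) *
          (15 * (n : ℝ) ^ (1 / (2 * (μ k : ℝ)))) := by
          gcongr
          exact (h1 k).2
      _ = 15 * C k * ((n : ℝ) ^ (1 / (2 * (μ k : ℝ))))⁻¹ ^ (M + 1) := by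
          rw [pow_succ _ (M + 1)]
          field_simp
      _ ≤ _ := by
          gcongr
          exact inv_rpow_pow_le hn (hκ.order_pos k) (Finset.le_sup (Finset.mem_univ k)) M
  refine (add_le_add e0 (Finset.sum_le_sum fun k _ => e1 k)).trans ?_
  rw [← Finset.sum_mul, mul_one_div, ← add_div]
  exact div_le_div_of_nonneg_right (by linarith) hD.le

end LocalLimit

end

theorem corollary1 (a : ℤ → ℂ) (ha : LocalLimit.HolomorphicNormalized a)
    (K : ℕ) (κ : Fin K → ℂ) (α : Fin K → ℝ) (β : Fin K → ℂ) (μ : Fin K → ℕ)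
    (hκ : LocalLimit.ParabolicTangency a K κ α β μ) (M : ℕ) :
    ∃ C : ℝ, 0 < C ∧
      ∀ (p : ℝ≥0∞), 1 ≤ p → ∀ (u : lp (fun _ : ℤ => ℂ) p) (n : ℕ), 1 ≤ n →
        LocalLimit.ConvDefined (LocalLimit.convPow a n) u ∧
        (∀ k, LocalLimit.ConvDefined
          (LocalLimit.leadingTerm a (κ k) (α k) (β k) (μ k) n) u) ∧
        (∀ k, ∀ m ∈ Finset.Icc 1 M, LocalLimit.ConvDefined
          (LocalLimit.corrector a (κ k) (α k) (β k) (μ k) m n) u) ∧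
        ∃ e : lp (fun _ : ℤ => ℂ) p,
          (∀ l : ℤ, e l =
            LocalLimit.conv (LocalLimit.convPow a n) u l
              - ∑ k, LocalLimit.conv
                  (LocalLimit.leadingTerm a (κ k) (α k) (β k) (μ k) n) u l
              - ∑ m ∈ Finset.Icc 1 M, ∑ k, LocalLimit.conv
                  (LocalLimit.corrector a (κ k) (α k) (β k) (μ k) m n) u l) ∧
          ‖e‖ ≤ C * ‖u‖ / (n : ℝ) ^ (((M : ℝ) + 1) / (2 * ((Finset.univ.sup μ : ℕ) : ℝ))) := by
  open LocalLimit in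
  obtain ⟨C, hC, hrem⟩ := exists_tsum_norm_remainder_le ha hκ M
  refine ⟨C, hC, fun p hp u n hn => ?_⟩
  have hconv := convDefined_of_summable hp (summable_norm_convPow ha.summable_norm n) u
  have hcorr : ∀ k m, ConvDefined (corrector a (κ k) (α k) (β k) (μ k) m n) u := fun k m =>
    convDefined_of_summable hp (summable_norm_scaledProfile (hκ.norm_point k) (hκ.norm_symbol k)
      (α k) (hκ.order_pos k) (hκ.re_pos k) m hn _) u
  have hlead : ∀ k, leadingTerm a (κ k) (α k) (β k) (μ k) n =
      corrector a (κ k) (α k) (β k) (μ k) 0 n := fun k => by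
    rw [leadingTerm, corrector, expansionPoly_zero, applyNegDeriv_one]
  refine ⟨hconv, fun k => hlead k ▸ hcorr k 0, fun k m _ => hcorr k m, ?_⟩
  obtain ⟨e, he, hnorm⟩ := exists_lp_conv hp (hrem n hn).1 u
  refine ⟨e, fun l => ?_, hnorm.trans ?_⟩
  · have hsum : ∀ k, ConvDefined (fun l => ∑ m ∈ Finset.range (M + 1),
        corrector a (κ k) (α k) (β k) (μ k) m n l) u := fun k l => by
      simp only [Finset.sum_mul]
      exact summable_sum fun m _ => hcorr k m l
    have hsum' : ConvDefined (fun l => ∑ k, ∑ m ∈ Finset.range (M + 1),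
        corrector a (κ k) (α k) (β k) (μ k) m n l) u := fun l => by
      simp only [Finset.sum_mul]
      exact summable_sum fun k _ => summable_sum fun m _ => hcorr k m l
    rw [he]
    change conv (fun l => convPow a n l - ∑ k, ∑ m ∈ Finset.range (M + 1),
      corrector a (κ k) (α k) (β k) (μ k) m n l) u l = _
    rw [conv_sub_left hconv hsum', conv_sum_left fun k _ => hsum k]
    simp only [conv_sum_left fun m _ => hcorr _ m, range_succ_eq_insert_Icc, hlead]
    rw [Finset.sum_comm, Finset.sum_insert (by simp), sub_sub]
  · rw [mul_div_right_comm]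
    exact mul_le_mul_of_nonneg_right (hrem n hn).2 (lp.norm_nonneg' _)
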